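/- For each $n\ge 1$ let $|\phi_n\rangle\in\mathcal H_A^{(n)}\otimes\mathcal H_B^{(n)}$ be a unit vector, with $\mathcal H_A^{(n)},\mathcal H_B^{(n)}$ arbitrary finite-dimensional Hilbert spaces, and let $\rho^A_n=\mathrm{Tr}_B|\phi_n\rangle\langle\phi_n|$, $\rho^B_n=\mathrm{Tr}_A|\phi_n\rangle\langle\phi_n|$. Logarithms are natural; suprema and infima are taken in $[-\infty,+\infty]$. **Spectral entropy rates.** For a sequence of states $\rho=(\rho_n)$ put $\Pi_n(\gamma)=\rho_n-e^{n\gamma}I$, let $\{X\ge 0\}$ denote the spectral projection of a self-adjoint $X$ onto $[0,\infty)$, and define $$\overline S(\rho)=-\sup\{\gamma\in\mathbb R:\liminf_n \mathrm{Tr}[\{\Pi_n(\gamma)\ge0\}\Pi_n(\gamma)]=1\},\qquad \underline S(\rho)=-\inf\{\gamma\in\mathbb R:\limsup_n \mathrm{Tr}[\{\Pi_n(\gamma)\ge0\}\Pi_n(\gamma)]=0\}.$$ The sequence is *information stable* if $\underline S(\rho)=\overline S(\rho)$. **Entanglement measures.** Let $|\Psi_M^+\rangle=M^{-1/2}\sum_{i=1}^M|i\rangle\otimes|i\rangle$,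 $M\ge1$. Fix a class of LOCC transformations: local operations with one-way classical communication (from $A$ to $B$ or from $B$ to $A$), or with two-way classical communication in finitely many rounds. A real $R$ is an achievable distillation rate if for every $\epsilon>0$ and all sufficiently large $n$ there are $M\ge1$ with $\frac1n\log M\ge R$ and a transformation $T$ of the class with $\langle\Psi_M^+|T(|\phi_n\rangle\langle\phi_n|)|\Psi_M^+\rangle\ge1-\epsilon$; $E_D$ is the supremum of these rates. A real $R$ is an achievable dilution rate if for every $\epsilon>0$ and all sufficiently large $n$ there are $M\ge1$ with $\frac1n\log M\le R$ and a transformation $T$ of the class with $\langle\phi_n|T(|\Psi_M^+\rangle\langle\Psi_M^+|)|\phi_n\rangle\ge1-\epsilon$; $E_C$ is the infimum of these rates. For each of these classes, and for $\rho=(\rho_n)$ either of the two reduced sequences $(\rho_n^A)$, $(\rho_n^B)$: 1. $E_D=\underline S(\rho)$ and $E_C=\overline S(\rho)$. Consequently $E_D=E_C$ if and only if $\rho$ is information stable. 2. Suppose in addition that the dimensions grow at most exponentially, i.e. there is $d$ with $\min(\dim\mathcal H_A^{(n)},\dim\mathcal H_B^{(n)})\le d^n$ for all $n\ge1$. If $E_D=E_C$,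 then the common value is finite and equals the von Neumann entropy rate $\lim_{n\to\infty}\frac1nS(\rho_n)$ (the limit exists), where $S(\rho)=-\mathrm{Tr}\,\rho\log\rho$. 3. Let $\sigma,\omega$ be states on a finite-dimensional Hilbert space $\mathcal H$ with $S(\sigma)<S(\omega)$, and let $t\in(0,1)$. Sequences of bipartite pure states with one reduced state on $\mathcal H^{\otimes n}$ equal to $t\,\sigma^{\otimes n}+(1-t)\,\omega^{\otimes n}$ for all $n\ge1$ exist, and every such sequence has $$E_D=S(\sigma)<S(\omega)=E_C;$$ in particular it is not information stable. -/

import Mathlib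

open scoped Kronecker ComplexOrder

noncomputable section

namespace BipartiteEntanglement

/-! ### States, partial traces, entropy -/

/-- A density matrix: a positive operator of unit trace. -/
def IsState {ι : Type} [Fintype ι] (ρ : Matrix ι ι ℂ) : Prop :=
  ρ.PosSemidef ∧ ρ.trace = 1

/-- The rank-one operator `|ψ⟩⟨ψ|`. -/
def ketBra {ι : Type} [Fintype ι] (ψ : EuclideanSpace ℂ ι) : Matrix ι ι ℂ :=
  Matrix.of fun i j => ψ i * star (ψ j)

/-- The partial trace over `B`: the reduced operator on `A`. -/
def reducedA {A B : Type} [Fintype B] (X : Matrix (A × B) (A × B) ℂ) : Matrix A A ℂ :=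
  Matrix.of fun i j => ∑ b, X (i, b) (j, b)

/-- The partial trace over `A`: the reduced operator on `B`. -/
def reducedB {A B : Type} [Fintype A] (X : Matrix (A × B) (A × B) ℂ) : Matrix B B ℂ :=
  Matrix.of fun i j => ∑ a, X (a, i) (a, j)

/-- The maximally entangled state `M^{-1/2} ∑ i, |i⟩ ⊗ |i⟩` of rank `M`. -/
def maxEntangled (M : ℕ) : EuclideanSpace ℂ (Fin M × Fin M) :=
  WithLp.toLp 2 fun p => if p.1 = p.2 then ((1 / Real.sqrt M : ℝ) : ℂ) else 0

/-- The fidelity `⟨ψ| X |ψ⟩` of a state `X` with a pure target state `ψ`. -/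
def fidelity {ι : Type} [Fintype ι] (ψ : EuclideanSpace ℂ ι) (X : Matrix ι ι ℂ) : ℝ :=
  (∑ i, ∑ j, star (ψ i) * X i j * ψ j).re

/-- The von Neumann entropy `S(ρ) = - Tr ρ log ρ` (natural logarithm). -/
def vonNeumannEntropy {ι : Type} [Fintype ι] [DecidableEq ι] (ρ : Matrix ι ι ℂ) : ℝ :=
  -(ρ * cfc Real.log ρ).trace.re

/-- The tensor power `σ^{⊗ n}`, acting on the space with basis `Fin n → ι`. -/
def tensorPower {ι : Type} (σ : Matrix ι ι ℂ) (n : ℕ) :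
    Matrix (Fin n → ι) (Fin n → ι) ℂ :=
  Matrix.of fun i j => ∏ k, σ (i k) (j k)

/-! ### Quantum spectral information rates -/

/-- The spectral projection `{X ≥ 0}` of a self-adjoint operator `X`. -/
def projNonneg {ι : Type} [Fintype ι] [DecidableEq ι] (X : Matrix ι ι ℂ) : Matrix ι ι ℂ :=
  cfc (Set.indicator (Set.Ici (0 : ℝ)) (fun _ => (1 : ℝ))) X

section Spectral

variable {ι : ℕ → Type} [∀ n, Fintype (ι n)] [∀ n, DecidableEq (ι n)]

/-- `Tr [{Π_n(γ) ≥ 0} Π_n(γ)]` for the difference operator `Π_n(γ) = ρ_n - e^{nγ} ω_n`. -/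
def spectralTrace (ρ ω : ∀ n, Matrix (ι n) (ι n) ℂ) (γ : ℝ) (n : ℕ) : ℝ :=
  (projNonneg (ρ n - ((Real.exp (n * γ) : ℝ) : ℂ) • ω n) *
    (ρ n - ((Real.exp (n * γ) : ℝ) : ℂ) • ω n)).trace.re

/-- The quantum spectral sup-divergence rate. -/
def supDivergenceRate (ρ ω : ∀ n, Matrix (ι n) (ι n) ℂ) : EReal :=
  sInf ((fun γ : ℝ => (γ : EReal)) ''
    {γ : ℝ | Filter.limsup (spectralTrace ρ ω γ) Filter.atTop = 0})

/-- The quantum spectral inf-divergence rate. -/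
def infDivergenceRate (ρ ω : ∀ n, Matrix (ι n) (ι n) ℂ) : EReal :=
  sSup ((fun γ : ℝ => (γ : EReal)) ''
    {γ : ℝ | Filter.liminf (spectralTrace ρ ω γ) Filter.atTop = 1})

/-- The sup-spectral entropy rate. -/
def supEntropyRate (ρ : ∀ n, Matrix (ι n) (ι n) ℂ) : EReal :=
  -infDivergenceRate ρ (fun _ => 1)

/-- The inf-spectral entropy rate. -/
def infEntropyRate (ρ : ∀ n, Matrix (ι n) (ι n) ℂ) : EReal :=
  -supDivergenceRate ρ (fun _ => 1)

/-- Information stability: the two spectral entropy rates agree. -/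
def IsInformationStable (ρ : ∀ n, Matrix (ι n) (ι n) ℂ) : Prop :=
  infEntropyRate ρ = supEntropyRate ρ

end Spectral

/-! ### Local operations and classical communication -/

/-- The family `K` is a complete set of Kraus (measurement) operators: `∑ Kₓ† Kₓ = 1`. -/
def IsKraus {A A' : Type} [Fintype A'] [DecidableEq A] {k : ℕ}
    (K : Fin k → Matrix A' A ℂ) : Prop :=
  ∑ x, (K x).conjTranspose * K x = 1

/-- The map `X ↦ K X K†`. -/
def conjBy {ι κ : Type} [Fintype ι] (K : Matrix κ ι ℂ) (X : Matrix ι ι ℂ) : Matrix κ κ ℂ :=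
  K * X * K.conjTranspose

/-- One-way LOCC from `A` to `B`: Alice measures, with Kraus operators `K x`, and sends the
outcome `x` to Bob, who applies the operation with Kraus operators `L x y`. -/
def IsForwardLOCC {A B A' B' : Type} [Fintype A] [DecidableEq A] [Fintype B] [DecidableEq B]
    [Fintype A'] [Fintype B']
    (T : Matrix (A × B) (A × B) ℂ → Matrix (A' × B') (A' × B') ℂ) : Prop :=
  ∃ (k l : ℕ) (K : Fin k → Matrix A' A ℂ) (L : Fin k → Fin l → Matrix B' B ℂ),
    IsKraus K ∧ (∀ x, IsKraus (L x)) ∧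
    ∀ X, T X = ∑ x, ∑ y, conjBy (K x ⊗ₖ L x y) X

/-- One-way LOCC from `B` to `A`. -/
def IsBackwardLOCC {A B A' B' : Type} [Fintype A] [DecidableEq A] [Fintype B] [DecidableEq B]
    [Fintype A'] [Fintype B']
    (T : Matrix (A × B) (A × B) ℂ → Matrix (A' × B') (A' × B') ℂ) : Prop :=
  ∃ (k l : ℕ) (L : Fin l → Matrix B' B ℂ) (K : Fin l → Fin k → Matrix A' A ℂ),
    IsKraus L ∧ (∀ y, IsKraus (K y)) ∧
    ∀ X, T X = ∑ y, ∑ x, conjBy (K y x ⊗ₖ L y) X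

/-- Two-way LOCC with finitely many rounds. The parties either finish with a local operation
each, or one of them measures, announces the outcome `x`, and they continue with an LOCC
protocol that may depend on `x`. -/
inductive IsTwoWayLOCC {A' B' : Type} [Fintype A'] [Fintype B'] :
    ∀ {A B : Type} [Fintype A] [DecidableEq A] [Fintype B] [DecidableEq B],
      (Matrix (A × B) (A × B) ℂ → Matrix (A' × B') (A' × B') ℂ) → Prop
  | localOps {A B : Type} [Fintype A] [DecidableEq A] [Fintype B] [DecidableEq B] {k l : ℕ}
      (K : Fin k → Matrix A' A ℂ) (L : Fin l → Matrix B' B ℂ)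
      (hK : IsKraus K) (hL : IsKraus L) :
      IsTwoWayLOCC (fun X : Matrix (A × B) (A × B) ℂ => ∑ x, ∑ y, conjBy (K x ⊗ₖ L y) X)
  | roundA {A B A₁ : Type} [Fintype A] [DecidableEq A] [Fintype B] [DecidableEq B]
      [Fintype A₁] [DecidableEq A₁] {k : ℕ}
      (K : Fin k → Matrix A₁ A ℂ) (hK : IsKraus K)
      (T : Fin k → Matrix (A₁ × B) (A₁ × B) ℂ → Matrix (A' × B') (A' × B') ℂ)
      (hT : ∀ x, IsTwoWayLOCC (T x)) :
      IsTwoWayLOCC (fun X : Matrix (A × B) (A × B) ℂ =>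
        ∑ x, T x (conjBy (K x ⊗ₖ (1 : Matrix B B ℂ)) X))
  | roundB {A B B₁ : Type} [Fintype A] [DecidableEq A] [Fintype B] [DecidableEq B]
      [Fintype B₁] [DecidableEq B₁] {l : ℕ}
      (L : Fin l → Matrix B₁ B ℂ) (hL : IsKraus L)
      (T : Fin l → Matrix (A × B₁) (A × B₁) ℂ → Matrix (A' × B') (A' × B') ℂ)
      (hT : ∀ y, IsTwoWayLOCC (T y)) :
      IsTwoWayLOCC (fun X : Matrix (A × B) (A × B) ℂ =>
        ∑ y, T y (conjBy ((1 : Matrix A A ℂ) ⊗ₖ L y) X))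

/-- The classes of LOCC transformations, according to the classical communication allowed. -/
inductive CommClass
  | forward
  | backward
  | twoWay

/-- `T` is an LOCC transformation of the given class. -/
def IsLOCC (c : CommClass) {A B A' B' : Type} [Fintype A] [DecidableEq A] [Fintype B]
    [DecidableEq B] [Fintype A'] [Fintype B']
    (T : Matrix (A × B) (A × B) ℂ → Matrix (A' × B') (A' × B') ℂ) : Prop :=
  match c with
  | CommClass.forward => IsForwardLOCC T
  | CommClass.backward => IsBackwardLOCC T
  | CommClass.twoWay => IsTwoWayLOCC T

/-! ### Entanglement rates -/

section Rates

variable {A B : ℕ → Type} [∀ n, Fintype (A n)] [∀ n, DecidableEq (A n)]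
  [∀ n, Fintype (B n)] [∀ n, DecidableEq (B n)]

/-- `R` is an achievable distillation rate for the sequence of bipartite states `ρ`. -/
def IsDistillationRate (c : CommClass)
    (ρ : ∀ n, Matrix (A n × B n) (A n × B n) ℂ) (R : ℝ) : Prop :=
  ∀ ε : ℝ, 0 < ε → ∃ N : ℕ, ∀ n : ℕ, N ≤ n → ∃ M : ℕ, 1 ≤ M ∧
    ∃ T : Matrix (A n × B n) (A n × B n) ℂ → Matrix (Fin M × Fin M) (Fin M × Fin M) ℂ,
      IsLOCC c T ∧ 1 - ε ≤ fidelity (maxEntangled M) (T (ρ n)) ∧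
      R ≤ 1 / (n : ℝ) * Real.log M

/-- `R` is an achievable dilution rate for the sequence of bipartite pure states `φ`. -/
def IsDilutionRate (c : CommClass)
    (φ : ∀ n, EuclideanSpace ℂ (A n × B n)) (R : ℝ) : Prop :=
  ∀ ε : ℝ, 0 < ε → ∃ N : ℕ, ∀ n : ℕ, N ≤ n → ∃ M : ℕ, 1 ≤ M ∧
    ∃ T : Matrix (Fin M × Fin M) (Fin M × Fin M) ℂ → Matrix (A n × B n) (A n × B n) ℂ,
      IsLOCC c T ∧ 1 - ε ≤ fidelity (φ n) (T (ketBra (maxEntangled M))) ∧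
      1 / (n : ℝ) * Real.log M ≤ R

/-- The distillable entanglement `E_D` of a sequence of bipartite pure states. -/
def distillableEntanglement (c : CommClass)
    (φ : ∀ n, EuclideanSpace ℂ (A n × B n)) : EReal :=
  sSup ((fun R : ℝ => (R : EReal)) '' {R : ℝ | IsDistillationRate c (fun n => ketBra (φ n)) R})

/-- The entanglement cost `E_C` of a sequence of bipartite pure states. -/
def entanglementCost (c : CommClass)
    (φ : ∀ n, EuclideanSpace ℂ (A n × B n)) : EReal :=
  sInf ((fun R : ℝ => (R : EReal)) '' {R : ℝ | IsDilutionRate c φ R})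

/-- The sequence of reduced states on `A`. -/
def reducedSeqA (φ : ∀ n, EuclideanSpace ℂ (A n × B n)) : ∀ n, Matrix (A n) (A n) ℂ :=
  fun n => reducedA (ketBra (φ n))

/-- The sequence of reduced states on `B`. -/
def reducedSeqB (φ : ∀ n, EuclideanSpace ℂ (A n × B n)) : ∀ n, Matrix (B n) (B n) ℂ :=
  fun n => reducedB (ketBra (φ n))

end Rates

/-- The mixture `t σ^{⊗ n} + (1 - t) ω^{⊗ n}`. -/
def mixedPower {ι : Type} (t : ℝ) (σ ω : Matrix ι ι ℂ) (n : ℕ) :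
    Matrix (Fin n → ι) (Fin n → ι) ℂ :=
  (t : ℂ) • tensorPower σ n + ((1 - t : ℝ) : ℂ) • tensorPower ω n

end BipartiteEntanglement

end

open BipartiteEntanglement

set_option linter.unusedSectionVars false

noncomputable section

namespace BipartiteEntanglement

open Matrix Filter Topology

/-! ### Functions of Hermitian matrices -/

section Hermitian

variable {m n : Type} [Fintype m] [DecidableEq m] [Fintype n] [DecidableEq n]

/-! Everything is expressed through `excess ρ q`, the trace of the positive part of ρ - q, which
equals `∑ max (λ - q) 0` over the eigenvalues and is the maximum of Tr Pρ - q Tr P over effects P.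
With q = e^{nγ} the two spectral entropy rates are thresholds in γ: where the excess begins to tend
to 0 and where it ceases to tend to 1. Both reduced states have the same nonzero spectrum, so the
side does not matter.

A bipartite vector is identified with its coefficient matrix Φ, and a product Kraus operator acts by
Φ ↦ KΦLᵀ. This never raises the rank, and the squared norms of the branches add up to that of Φ. All
LOCC classes consist of maps with product Kraus operators, so the converses are proved for these;
the protocols use one-way communication, in either direction.

Dilution: a branch of Ψ_M has rank at most M, so the fidelity is at most excess(q) + Mq
(`dilution_fidelity_le`). Conversely, at most 1/q eigenvalues are ≥ q, and the vector truncated to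
them is produced exactly (`oneWayAchieves_dilution`). Distillation: the part of Φ over eigenvalues ≥
q has rank at most 1/q and overlaps little with Ψ_M when M is much larger than 1/q
(`distillation_excess_le`). Conversely, eigenvalues capped at q can be packed into M bins of almost
equal weight (`oneWayAchieves_of_bins`).

For the entropy rate, pointwise bounds on -x log x compare S(ρ) with -log q and the excess, the rank
bound controlling the tail. For mixtures, a Chernoff bound locates the threshold of σ^{⊗n} at -S(σ),
and variational bounds for the excess of a mixture show that the component of smaller entropy fixes
one rate and the other component fixes the other. -/

lemma cfc_eq_conj {H : Matrix m m ℂ} (hH : H.IsHermitian) (f : ℝ → ℝ) :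
    cfc f H = (hH.eigenvectorUnitary : Matrix m m ℂ) *
      diagonal (fun i => (f (hH.eigenvalues i) : ℂ)) *
      (hH.eigenvectorUnitary : Matrix m m ℂ)ᴴ := by
  rw [hH.cfc_eq f, IsHermitian.cfc, Unitary.conjStarAlgAut_apply]
  rfl

lemma conjTranspose_mul_eigenvectorUnitary {H : Matrix m m ℂ} (hH : H.IsHermitian) :
    (hH.eigenvectorUnitary : Matrix m m ℂ)ᴴ * hH.eigenvectorUnitary = 1 :=
  Unitary.coe_star_mul_self hH.eigenvectorUnitary

lemma eigenvectorUnitary_mul_conjTranspose {H : Matrix m m ℂ} (hH : H.IsHermitian) :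
    (hH.eigenvectorUnitary : Matrix m m ℂ) * (hH.eigenvectorUnitary : Matrix m m ℂ)ᴴ = 1 :=
  Unitary.coe_mul_star_self hH.eigenvectorUnitary

lemma spectral_decomposition {H : Matrix m m ℂ} (hH : H.IsHermitian) :
    H = (hH.eigenvectorUnitary : Matrix m m ℂ) *
      diagonal (fun i => (hH.eigenvalues i : ℂ)) *
      (hH.eigenvectorUnitary : Matrix m m ℂ)ᴴ := by
  conv_lhs => rw [← cfc_id ℝ H hH.isSelfAdjoint, cfc_eq_conj hH]
  rfl

lemma trace_cfc {H : Matrix m m ℂ} (hH : H.IsHermitian) (f : ℝ → ℝ) :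
    (cfc f H).trace = ((∑ i, f (hH.eigenvalues i) : ℝ) : ℂ) := by
  rw [cfc_eq_conj hH, trace_mul_cycle, conjTranspose_mul_eigenvectorUnitary, one_mul,
    trace_diagonal]
  push_cast; rfl

lemma rank_cfc_le {H : Matrix m m ℂ} (hH : H.IsHermitian) (f : ℝ → ℝ) :
    (cfc f H).rank ≤ Fintype.card {i // f (hH.eigenvalues i) ≠ 0} := by
  rw [cfc_eq_conj hH]
  refine ((rank_mul_le_left _ _).trans (rank_mul_le_right _ _)).trans ?_
  rw [rank_diagonal]
  simp

lemma continuousOn_spectrum (H : Matrix m m ℂ) (f : ℝ → ℝ) : ContinuousOn f (spectrum ℝ H) :=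
  (finite_real_spectrum (A := H)).continuousOn f

lemma isHermitian_cfc (H : Matrix m m ℂ) (f : ℝ → ℝ) : (cfc f H).IsHermitian :=
  cfc_predicate f H

lemma posSemidef_cfc {H : Matrix m m ℂ} (hH : H.IsHermitian) {f : ℝ → ℝ} (hf : ∀ x, 0 ≤ f x) :
    (cfc f H).PosSemidef := by
  rw [cfc_eq_conj hH]
  refine PosSemidef.mul_mul_conjTranspose_same (PosSemidef.diagonal fun i => ?_) _
  simpa using hf _

lemma cfc_mul' (H : Matrix m m ℂ) (f g : ℝ → ℝ) :
    cfc f H * cfc g H = cfc (fun x => f x * g x) H :=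
  (cfc_mul f g H (continuousOn_spectrum H f) (continuousOn_spectrum H g)).symm

lemma mul_cfc {H : Matrix m m ℂ} (hH : H.IsHermitian) (f : ℝ → ℝ) :
    H * cfc f H = cfc (fun x => x * f x) H := by
  conv_lhs => enter [1]; rw [← cfc_id' ℝ H hH.isSelfAdjoint]
  exact cfc_mul' H _ _

lemma cfc_mul_self {H : Matrix m m ℂ} (hH : H.IsHermitian) (f : ℝ → ℝ) :
    cfc f H * H = cfc (fun x => f x * x) H := by
  conv_lhs => enter [2]; rw [← cfc_id' ℝ H hH.isSelfAdjoint]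
  exact cfc_mul' H _ _

lemma vonNeumannEntropy_eq {H : Matrix m m ℂ} (hH : H.IsHermitian) :
    vonNeumannEntropy H = ∑ i, Real.negMulLog (hH.eigenvalues i) := by
  rw [vonNeumannEntropy, mul_cfc hH, trace_cfc hH, Complex.ofReal_re, ← Finset.sum_neg_distrib]
  exact Finset.sum_congr rfl fun i _ => by simp [Real.negMulLog]

/-- The trace of the positive part of `ρ - q`. -/
def excess (ρ : Matrix m m ℂ) (q : ℝ) : ℝ :=
  (projNonneg (ρ - (q : ℂ) • 1) * (ρ - (q : ℂ) • 1)).trace.re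

lemma cfc_sub_smul_one {H : Matrix m m ℂ} (hH : H.IsHermitian) (q : ℝ) (f : ℝ → ℝ) :
    cfc f (H - (q : ℂ) • 1) = cfc (fun x => f (x - q)) H := by
  have h : H - (q : ℂ) • 1 = cfc (fun x => x - q) H := by
    rw [cfc_eq_conj hH]
    conv_lhs => rw [spectral_decomposition hH]
    have : (diagonal fun i => ((hH.eigenvalues i - q : ℝ) : ℂ)) =
        diagonal (fun i => (hH.eigenvalues i : ℂ)) - (q : ℂ) • (1 : Matrix m m ℂ) := by
      ext i j
      by_cases hij : i = j <;> simp [hij]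
    rw [this, Matrix.mul_sub, Matrix.sub_mul, Matrix.mul_smul, Matrix.smul_mul, Matrix.mul_one,
      eigenvectorUnitary_mul_conjTranspose]
  rw [h]
  exact (cfc_comp' f (fun x => x - q) H
    (((finite_real_spectrum (A := H)).image _).continuousOn f)
    (continuousOn_spectrum H _) hH.isSelfAdjoint).symm

lemma isHermitian_sub_smul_one {H : Matrix m m ℂ} (hH : H.IsHermitian) (q : ℝ) :
    (H - (q : ℂ) • (1 : Matrix m m ℂ)).IsHermitian := by
  refine hH.sub ?_
  rw [IsHermitian, conjTranspose_smul]; simp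

lemma excess_eq_sum {ρ : Matrix m m ℂ} (hρ : ρ.IsHermitian) (q : ℝ) :
    excess ρ q = ∑ i, max (hρ.eigenvalues i - q) 0 := by
  rw [excess, projNonneg, cfc_mul_self (isHermitian_sub_smul_one hρ q), cfc_sub_smul_one hρ,
    trace_cfc hρ, Complex.ofReal_re]
  refine Finset.sum_congr rfl fun i _ => ?_
  by_cases h : 0 ≤ hρ.eigenvalues i - q
  · rw [Set.indicator_of_mem (Set.mem_Ici.2 h), one_mul, max_eq_left h]
  · rw [Set.indicator_of_notMem (by simpa using h), zero_mul, max_eq_right (by linarith)]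

lemma IsState.sum_eigenvalues {ρ : Matrix m m ℂ} (h : IsState ρ) :
    ∑ i, h.1.1.eigenvalues i = 1 := by
  have : ((∑ i, h.1.1.eigenvalues i : ℝ) : ℂ) = 1 := by
    push_cast
    exact h.1.1.trace_eq_sum_eigenvalues.symm.trans h.2
  exact_mod_cast this

lemma IsState.excess_nonneg {ρ : Matrix m m ℂ} (h : IsState ρ) (q : ℝ) : 0 ≤ excess ρ q := by
  rw [excess_eq_sum h.1.1]
  exact Finset.sum_nonneg fun i _ => le_max_right _ _

lemma IsState.excess_le_one {ρ : Matrix m m ℂ} (h : IsState ρ) {q : ℝ} (hq : 0 ≤ q) :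
    excess ρ q ≤ 1 := by
  rw [excess_eq_sum h.1.1, ← h.sum_eigenvalues]
  exact Finset.sum_le_sum fun i _ =>
    max_le (by linarith) (h.1.eigenvalues_nonneg i)

lemma IsState.excess_anti {ρ : Matrix m m ℂ} (h : IsState ρ) {q q' : ℝ} (hq : q ≤ q') :
    excess ρ q' ≤ excess ρ q := by
  rw [excess_eq_sum h.1.1, excess_eq_sum h.1.1]
  gcongr

lemma IsState.sum_min {ρ : Matrix m m ℂ} (h : IsState ρ) (q : ℝ) :
    ∑ i, min (h.1.1.eigenvalues i) q = 1 - excess ρ q := by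
  rw [excess_eq_sum h.1.1, ← h.sum_eigenvalues, ← Finset.sum_sub_distrib]
  refine Finset.sum_congr rfl fun i _ => ?_
  rcases le_total (h.1.1.eigenvalues i) q with hi | hi
  · rw [min_eq_left hi, max_eq_right (by linarith)]; ring
  · rw [min_eq_right hi, max_eq_left (by linarith)]; ring

lemma trace_mul_nonneg_of_posSemidef {P Q : Matrix m m ℂ} (hP : P.PosSemidef)
    (hQ : Q.PosSemidef) : 0 ≤ (P * Q).trace.re := by
  open scoped MatrixOrder in
  obtain ⟨B, rfl⟩ := CStarAlgebra.nonneg_iff_eq_star_mul_self.mp hP.nonneg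
  rw [star_eq_conjTranspose, Matrix.mul_assoc, trace_mul_comm]
  have := (hQ.mul_mul_conjTranspose_same B).trace_nonneg
  exact (Complex.le_def.1 this).1

/-- The trace of the positive part dominates every compression by an effect. -/
lemma trace_mul_le_excess {ρ P : Matrix m m ℂ} (hρ : ρ.IsHermitian) (hP : P.PosSemidef)
    (hP1 : (1 - P).PosSemidef) (q : ℝ) :
    (P * ρ).trace.re - q * P.trace.re ≤ excess ρ q := by
  set X := ρ - (q : ℂ) • (1 : Matrix m m ℂ) with hX
  have hXh : X.IsHermitian := isHermitian_sub_smul_one hρ q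
  set Y := cfc (fun x : ℝ => max x 0) X with hY
  set Z := cfc (fun x : ℝ => max (-x) 0) X with hZ
  -- Jordan decomposition: Tr PX = Tr PY - Tr PZ ≤ Tr Y, because P and 1 - P are positive.
  have hXYZ : X = Y - Z := by
    rw [hY, hZ, ← cfc_sub _ _ X (continuousOn_spectrum X _) (continuousOn_spectrum X _)]
    conv_lhs => rw [← cfc_id' ℝ X hXh.isSelfAdjoint]
    congr 1; funext x
    rcases le_total x 0 with h | h
    · rw [max_eq_right h, max_eq_left (by linarith)]; ring
    · rw [max_eq_left h, max_eq_right (by linarith)]; ring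
  have hYtr : Y.trace.re = excess ρ q := by
    rw [hY, hX, cfc_sub_smul_one hρ, trace_cfc hρ, excess_eq_sum hρ, Complex.ofReal_re]
  have hYp : Y.PosSemidef := posSemidef_cfc hXh fun x => le_max_right _ _
  have hZp : Z.PosSemidef := posSemidef_cfc hXh fun x => le_max_right _ _
  have h1 := trace_mul_nonneg_of_posSemidef hP hZp
  have h2 := trace_mul_nonneg_of_posSemidef hP1 hYp
  have h3 : (P * X).trace.re = (P * ρ).trace.re - q * P.trace.re := by
    rw [hX, Matrix.mul_sub, Matrix.mul_smul, Matrix.mul_one, trace_sub, trace_smul]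
    simp
  rw [hXYZ, Matrix.mul_sub, trace_sub, Complex.sub_re] at h3
  rw [Matrix.sub_mul, Matrix.one_mul, trace_sub, Complex.sub_re] at h2
  linarith

/-- An orthogonal projection. -/
structure IsOrthProj (P : Matrix m m ℂ) : Prop where
  isHermitian : P.IsHermitian
  mul_self : P * P = P

lemma IsOrthProj.posSemidef {P : Matrix m m ℂ} (h : IsOrthProj P) : P.PosSemidef := by
  have := posSemidef_conjTranspose_mul_self P
  rwa [h.isHermitian, h.mul_self] at this

lemma IsOrthProj.one_sub {P : Matrix m m ℂ} (h : IsOrthProj P) : IsOrthProj (1 - P) :=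
  ⟨isHermitian_one.sub h.isHermitian, by
    rw [Matrix.mul_sub, Matrix.mul_one, Matrix.sub_mul, Matrix.one_mul, h.mul_self]; simp⟩

lemma IsOrthProj.trace_mul_le_excess {ρ P : Matrix m m ℂ} (h : IsOrthProj P)
    (hρ : ρ.IsHermitian) (q : ℝ) : (P * ρ).trace.re - q * P.trace.re ≤ excess ρ q :=
  BipartiteEntanglement.trace_mul_le_excess hρ h.posSemidef h.one_sub.posSemidef q

lemma isOrthProj_cfc (H : Matrix m m ℂ) {f : ℝ → ℝ} (hf : ∀ x, f x * f x = f x) :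
    IsOrthProj (cfc f H) :=
  ⟨isHermitian_cfc H f, by rw [cfc_mul']; congr 1; funext x; exact hf x⟩

/-- The spectral projection `{ρ ≥ q}` attains the trace of the positive part. -/
lemma exists_spectralProj {ρ : Matrix m m ℂ} (hρ : ρ.IsHermitian) (q : ℝ) :
    ∃ P : Matrix m m ℂ, IsOrthProj P ∧ (P.rank : ℝ) ≤ P.trace.re ∧
      (P * ρ).trace.re - q * P.trace.re = excess ρ q := by
  classical
  set f : ℝ → ℝ := fun x => if q ≤ x then 1 else 0 with hf
  refine ⟨cfc f ρ, isOrthProj_cfc ρ fun x => by simp only [hf]; split_ifs <;> simp, ?_, ?_⟩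
  · refine (Nat.cast_le.2 (rank_cfc_le hρ f)).trans ?_
    rw [trace_cfc hρ, Complex.ofReal_re, Fintype.card_subtype]
    simp [hf]
  · rw [cfc_mul_self hρ, trace_cfc hρ, trace_cfc hρ, Complex.ofReal_re, Complex.ofReal_re,
      excess_eq_sum hρ, Finset.mul_sum, ← Finset.sum_sub_distrib]
    refine Finset.sum_congr rfl fun i _ => ?_
    simp only [hf]
    split_ifs with h
    · rw [max_eq_left (by linarith)]; ring
    · rw [max_eq_right (by linarith)]; ring

/-- The orthogonal projection onto the range of a matrix. -/
lemma exists_rangeProj (X : Matrix m n ℂ) :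
    ∃ P : Matrix m m ℂ, IsOrthProj P ∧ P.trace.re = X.rank ∧ P * X = X := by
  classical
  have hH : (X * Xᴴ).IsHermitian := isHermitian_mul_conjTranspose_self X
  set f : ℝ → ℝ := fun x => if x = 0 then 0 else 1 with hf
  have hP : IsOrthProj (cfc f (X * Xᴴ)) :=
    isOrthProj_cfc _ fun x => by simp only [hf]; split_ifs <;> simp
  refine ⟨_, hP, ?_, ?_⟩
  · rw [trace_cfc hH, Complex.ofReal_re, ← rank_self_mul_conjTranspose X,
      hH.rank_eq_card_non_zero_eigs, Fintype.card_subtype]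
    simp only [hf, Finset.sum_ite, Finset.sum_const_zero, zero_add, Finset.sum_const]
    simp
  · have h1 : cfc f (X * Xᴴ) * (X * Xᴴ) = X * Xᴴ := by
      rw [cfc_mul_self hH]
      conv_rhs => rw [← cfc_id' ℝ (X * Xᴴ) hH.isSelfAdjoint]
      congr 1; funext x; simp only [hf]; split_ifs with h <;> simp [h]
    -- PX = X follows from (PX - X)(PX - X)ᴴ = 0, where only P(XXᴴ) = XXᴴ is needed.
    rw [← sub_eq_zero, ← self_mul_conjTranspose_eq_zero, conjTranspose_sub, conjTranspose_mul,
      hP.isHermitian, Matrix.sub_mul, Matrix.mul_sub, Matrix.mul_sub]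
    have h2 : cfc f (X * Xᴴ) * X * (Xᴴ * cfc f (X * Xᴴ)) = X * Xᴴ * cfc f (X * Xᴴ) := by
      rw [← Matrix.mul_assoc, Matrix.mul_assoc _ X, h1]
    rw [h2, Matrix.mul_assoc _ X, h1, Matrix.mul_assoc X]
    simp

end Hermitian

/-! ### Sums over eigenvalues and characteristic polynomials -/

section Charpoly

variable {m n : Type} [Fintype m] [DecidableEq m] [Fintype n] [DecidableEq n]

open Polynomial in
-- The roots of the characteristic polynomial are compared as multisets. The powers of X only add
-- zero roots, which `f 0 = 0` makes invisible; this allows matrices of different sizes.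
lemma sum_eigenvalues_of_charpoly {H : Matrix m m ℂ} (hH : H.IsHermitian) {ι : Type} [Fintype ι]
    {d : ι → ℝ} (a b : ℕ)
    (h : (X : ℂ[X]) ^ a * H.charpoly = X ^ b * ∏ i, (X - C (d i : ℂ)))
    {f : ℝ → ℝ} (hf : f 0 = 0) :
    ∑ i, f (hH.eigenvalues i) = ∑ i, f (d i) := by
  rw [hH.charpoly_eq] at h
  have hne : ∀ {κ : Type} [Fintype κ] (e : κ → ℝ), ∏ i, (X - C (e i : ℂ)) ≠ (0 : ℂ[X]) :=
    fun e => Finset.prod_ne_zero_iff.2 fun i _ => X_sub_C_ne_zero _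
  have hr : ∀ {κ : Type} [Fintype κ] (e : κ → ℝ),
      (∏ i, (X - C (e i : ℂ)) : ℂ[X]).roots = Finset.univ.val.map fun i => (e i : ℂ) := by
    intro κ _ e
    rw [roots_prod _ _ (hne e)]
    simp
  have h' := congrArg roots h
  have hX : ∀ k : ℕ, (X : ℂ[X]) ^ k ≠ 0 := fun k => pow_ne_zero _ X_ne_zero
  erw [roots_mul (mul_ne_zero (hX a) (hne _)), roots_mul (mul_ne_zero (hX b) (hne _)),
    hr, hr, roots_X_pow, roots_X_pow] at h'
  have h2 := congrArg (fun s => (s.map fun z : ℂ => f z.re).sum) h'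
  simpa [Multiset.map_nsmul, Multiset.sum_nsmul, hf] using h2

lemma sum_eigenvalues_conj {H V : Matrix m m ℂ} (hH : H.IsHermitian) (hV : Vᴴ * V = 1)
    {d : m → ℝ} (h : H = V * diagonal (fun i => (d i : ℂ)) * Vᴴ) {f : ℝ → ℝ} (hf : f 0 = 0) :
    ∑ i, f (hH.eigenvalues i) = ∑ i, f (d i) := by
  refine sum_eigenvalues_of_charpoly hH 0 0 ?_ hf
  rw [h, charpoly_mul_comm, ← Matrix.mul_assoc, hV, Matrix.one_mul, charpoly_diagonal]

/-- The spectral content of the Schmidt decomposition: ΦΦᴴ and ΦᴴΦ have the same characteristic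
polynomial up to powers of X, and the reduced state on B is the transpose of ΦᴴΦ. -/
lemma sum_eigenvalues_gram (Φ : Matrix m n ℂ) {Y : Matrix n n ℂ}
    (hH : (Φ * Φᴴ).IsHermitian) (hY : Y.IsHermitian) (h : Y = Φᵀ * Φᴴᵀ)
    {f : ℝ → ℝ} (hf : f 0 = 0) :
    ∑ i, f (hH.eigenvalues i) = ∑ i, f (hY.eigenvalues i) := by
  refine sum_eigenvalues_of_charpoly hH (Fintype.card n) (Fintype.card m) ?_ hf
  have := hY.charpoly_eq
  erw [← this]
  rw [h, ← transpose_mul, charpoly_transpose]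
  exact charpoly_mul_comm' Φ Φᴴ

end Charpoly

/-! ### The Frobenius norm and coefficient matrices -/

section Frobenius

variable {m n : Type} [Fintype m] [Fintype n]

/-- The squared Frobenius norm. -/
def frobSq (X : Matrix m n ℂ) : ℝ := ∑ i, ∑ j, ‖X i j‖ ^ 2

lemma frobSq_nonneg (X : Matrix m n ℂ) : 0 ≤ frobSq X := by
  unfold frobSq; positivity

lemma frobSq_transpose (X : Matrix m n ℂ) : frobSq Xᵀ = frobSq X := Finset.sum_comm

lemma re_trace_mul_conjTranspose (X : Matrix m n ℂ) : (X * Xᴴ).trace.re = frobSq X := by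
  simp only [trace, diag_apply, mul_apply, conjTranspose_apply, Complex.re_sum, frobSq]
  refine Finset.sum_congr rfl fun i _ => Finset.sum_congr rfl fun j _ => ?_
  rw [RCLike.star_def, Complex.mul_conj, Complex.ofReal_re, Complex.normSq_eq_norm_sq]

lemma trace_conjTranspose_mul (Y X : Matrix m n ℂ) :
    (Yᴴ * X).trace = ∑ i, ∑ j, star (Y i j) * X i j := by
  simp only [trace, diag_apply, mul_apply, conjTranspose_apply]
  exact Finset.sum_comm

lemma norm_trace_sq_le (Y X : Matrix m n ℂ) :
    ‖(Yᴴ * X).trace‖ ^ 2 ≤ frobSq Y * frobSq X := by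
  have h : ‖(Yᴴ * X).trace‖ ≤ ∑ p : m × n, ‖Y p.1 p.2‖ * ‖X p.1 p.2‖ := by
    rw [trace_conjTranspose_mul, ← Fintype.sum_prod_type']
    refine (norm_sum_le _ _).trans (le_of_eq ?_)
    exact Finset.sum_congr rfl fun p _ => by rw [norm_mul, norm_star]
  have h2 := Finset.sum_mul_sq_le_sq_mul_sq Finset.univ
    (fun p : m × n => ‖Y p.1 p.2‖) (fun p : m × n => ‖X p.1 p.2‖)
  rw [frobSq, frobSq, ← Fintype.sum_prod_type', ← Fintype.sum_prod_type']
  exact (pow_le_pow_left₀ (norm_nonneg _) h 2).trans h2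

lemma IsOrthProj.frobSq_mul {P : Matrix m m ℂ} (h : IsOrthProj P) (Y : Matrix m n ℂ) :
    frobSq (P * Y) = (P * (Y * Yᴴ)).trace.re := by
  rw [← re_trace_mul_conjTranspose, conjTranspose_mul, h.isHermitian, ← Matrix.mul_assoc,
    trace_mul_comm, ← Matrix.mul_assoc, ← Matrix.mul_assoc, h.mul_self, Matrix.mul_assoc]

/-- If the range of X lies in that of P, the inner product with Y only sees PY. Rank bounds on X
thus become bounds on overlaps. -/
lemma norm_trace_sq_le_of_proj {P : Matrix m m ℂ} (h : IsOrthProj P) {Y X : Matrix m n ℂ}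
    (hX : P * X = X) :
    ‖(Yᴴ * X).trace‖ ^ 2 ≤ (P * (Y * Yᴴ)).trace.re * frobSq X := by
  rw [← h.frobSq_mul]
  refine le_trans (le_of_eq ?_) (norm_trace_sq_le _ _)
  rw [conjTranspose_mul, h.isHermitian, Matrix.mul_assoc, hX]

/-- The coefficient matrix of a bipartite vector. -/
def coeffMatrix (φ : EuclideanSpace ℂ (m × n)) : Matrix m n ℂ := of fun a b => φ (a, b)

lemma frobSq_coeffMatrix (φ : EuclideanSpace ℂ (m × n)) : frobSq (coeffMatrix φ) = ‖φ‖ ^ 2 := by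
  rw [EuclideanSpace.norm_sq_eq, Fintype.sum_prod_type]; rfl

lemma reducedA_ketBra (φ : EuclideanSpace ℂ (m × n)) :
    reducedA (ketBra φ) = coeffMatrix φ * (coeffMatrix φ)ᴴ := rfl

lemma isState_gram {Φ : Matrix m n ℂ} (h : frobSq Φ = 1) : IsState (Φ * Φᴴ) := by
  refine ⟨posSemidef_self_mul_conjTranspose Φ, ?_⟩
  have h1 := re_trace_mul_conjTranspose Φ
  have h2 := (Complex.le_def.1 (posSemidef_self_mul_conjTranspose Φ).trace_nonneg).2
  exact Complex.ext (by rw [h1, h]; rfl) h2.symm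

variable [DecidableEq m] [DecidableEq n]

lemma excess_reducedB_eq (φ : EuclideanSpace ℂ (m × n)) {q : ℝ} (hq : 0 ≤ q) :
    excess (reducedB (ketBra φ)) q = excess (reducedA (ketBra φ)) q := by
  have hA : (reducedA (ketBra φ)).IsHermitian := isHermitian_mul_conjTranspose_self _
  have hB : (reducedB (ketBra φ)).IsHermitian := isHermitian_mul_conjTranspose_self (coeffMatrix φ)ᵀ
  rw [excess_eq_sum hA, excess_eq_sum hB]
  exact (sum_eigenvalues_gram (coeffMatrix φ) hA hB rfl (f := fun x => max (x - q) 0)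
    (by simpa using hq)).symm

lemma vonNeumannEntropy_reducedB_eq (φ : EuclideanSpace ℂ (m × n)) :
    vonNeumannEntropy (reducedB (ketBra φ)) = vonNeumannEntropy (reducedA (ketBra φ)) := by
  have hA : (reducedA (ketBra φ)).IsHermitian := isHermitian_mul_conjTranspose_self _
  have hB : (reducedB (ketBra φ)).IsHermitian := isHermitian_mul_conjTranspose_self (coeffMatrix φ)ᵀ
  rw [vonNeumannEntropy_eq hA, vonNeumannEntropy_eq hB]
  exact (sum_eigenvalues_gram (coeffMatrix φ) hA hB rfl Real.negMulLog_zero).symm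

end Frobenius

/-! ### Fidelities of Kraus maps -/

section Kraus

variable {A B A' B' : Type} [Fintype A] [DecidableEq A] [Fintype B] [DecidableEq B]
  [Fintype A'] [Fintype B']

/-- Vectorisation: local operators become left and right multiplications of the coefficient matrix,
so the estimates below are about ranks and Frobenius norms. -/
lemma kronecker_mulVec_apply (K : Matrix A' A ℂ) (L : Matrix B' B ℂ) (Φ : Matrix A B ℂ)
    (p : A' × B') :
    ((K ⊗ₖ L) *ᵥ fun q : A × B => Φ q.1 q.2) p = (K * Φ * Lᵀ) p.1 p.2 := by
  simp only [mulVec, dotProduct, kroneckerMap_apply, Fintype.sum_prod_type, mul_apply,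
    transpose_apply, Finset.sum_mul]
  rw [Finset.sum_comm]
  exact Finset.sum_congr rfl fun b _ => Finset.sum_congr rfl fun a _ => by ring

lemma fidelity_sum {ι J : Type} [Fintype ι] [Fintype J] (ψ : EuclideanSpace ℂ ι)
    (X : J → Matrix ι ι ℂ) : fidelity ψ (∑ j, X j) = ∑ j, fidelity ψ (X j) := by
  simp only [fidelity, Matrix.sum_apply, Finset.mul_sum, Finset.sum_mul, ← Complex.re_sum]
  congr 1
  conv_rhs => rw [Finset.sum_comm]
  refine Finset.sum_congr rfl fun i _ => ?_
  rw [Finset.sum_comm]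

lemma conjBy_ketBra {ι κ : Type} [Fintype ι] [Fintype κ] (N : Matrix κ ι ℂ)
    (φ : EuclideanSpace ℂ ι) :
    conjBy N (ketBra φ) = of fun i j => (N *ᵥ φ) i * star ((N *ᵥ φ) j) := by
  have : ketBra φ = vecMulVec φ (star (φ : ι → ℂ)) := rfl
  rw [conjBy, this, mul_vecMulVec, vecMulVec_mul, ← star_mulVec]
  rfl

lemma fidelity_ketBra {ι : Type} [Fintype ι] (ψ : EuclideanSpace ℂ ι) (v : ι → ℂ) :
    fidelity ψ (of fun i j => v i * star (v j)) = ‖∑ i, star (ψ i) * v i‖ ^ 2 := by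
  rw [fidelity, ← Complex.normSq_eq_norm_sq, ← Complex.ofReal_re (Complex.normSq _),
    Complex.normSq_eq_conj_mul_self, mul_comm, map_sum, Finset.sum_mul_sum]
  congr 1
  refine Finset.sum_congr rfl fun i _ => Finset.sum_congr rfl fun j _ => ?_
  simp
  ring

lemma fidelity_conjBy (ψ : EuclideanSpace ℂ (A' × B')) (φ : EuclideanSpace ℂ (A × B))
    (K : Matrix A' A ℂ) (L : Matrix B' B ℂ) :
    fidelity ψ (conjBy (K ⊗ₖ L) (ketBra φ)) =
      ‖((coeffMatrix ψ)ᴴ * (K * coeffMatrix φ * Lᵀ)).trace‖ ^ 2 := by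
  rw [conjBy_ketBra, fidelity_ketBra, trace_conjTranspose_mul, Fintype.sum_prod_type]
  congr 2
  refine Finset.sum_congr rfl fun i _ => Finset.sum_congr rfl fun j _ => ?_
  rw [← kronecker_mulVec_apply K L (coeffMatrix φ) (i, j)]
  rfl

lemma sum_frobSq_of_kraus {J : Type} [Fintype J] {K : J → Matrix A' A ℂ}
    {L : J → Matrix B' B ℂ} (h : ∑ j, (K j ⊗ₖ L j)ᴴ * (K j ⊗ₖ L j) = 1) (Φ : Matrix A B ℂ) :
    ∑ j, frobSq (K j * Φ * (L j)ᵀ) = frobSq Φ := by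
  set v : A × B → ℂ := fun q => Φ q.1 q.2 with hv
  have hfrob : ∀ {ι κ : Type} [Fintype ι] [Fintype κ] (Y : Matrix ι κ ℂ) (w : ι × κ → ℂ),
      (∀ p, w p = Y p.1 p.2) → frobSq Y = (star w ⬝ᵥ w).re := by
    intro ι κ _ _ Y w hw
    simp only [frobSq, dotProduct, Complex.re_sum, Fintype.sum_prod_type]
    refine Finset.sum_congr rfl fun i _ => Finset.sum_congr rfl fun j _ => ?_
    rw [Pi.star_apply, RCLike.star_def, ← Complex.normSq_eq_conj_mul_self, Complex.ofReal_re,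
      Complex.normSq_eq_norm_sq, hw]
  rw [hfrob Φ v fun _ => rfl]
  have : ∀ j, frobSq (K j * Φ * (L j)ᵀ) =
      (star v ⬝ᵥ (((K j ⊗ₖ L j)ᴴ * (K j ⊗ₖ L j)) *ᵥ v)).re := by
    intro j
    rw [hfrob _ ((K j ⊗ₖ L j) *ᵥ v) fun p => kronecker_mulVec_apply _ _ _ _, star_mulVec,
      ← dotProduct_mulVec, mulVec_mulVec]
  simp only [this]
  rw [← Complex.re_sum, ← dotProduct_sum, ← sum_mulVec, h, one_mulVec]

/-- `T` has a Kraus representation by product operators. -/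
def IsSeparable (T : Matrix (A × B) (A × B) ℂ → Matrix (A' × B') (A' × B') ℂ) : Prop :=
  ∃ (J : Type) (_ : Fintype J) (K : J → Matrix A' A ℂ) (L : J → Matrix B' B ℂ),
    ∑ j, (K j ⊗ₖ L j)ᴴ * (K j ⊗ₖ L j) = 1 ∧ ∀ X, T X = ∑ j, conjBy (K j ⊗ₖ L j) X

lemma kronecker_conjTranspose_mul_self (K : Matrix A' A ℂ) (L : Matrix B' B ℂ) :
    (K ⊗ₖ L)ᴴ * (K ⊗ₖ L) = (Kᴴ * K) ⊗ₖ (Lᴴ * L) := by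
  rw [conjTranspose_kronecker, mul_kronecker_mul]

lemma kronecker_sum {J : Type} [Fintype J] (X : Matrix A A ℂ) (Y : J → Matrix B B ℂ) :
    ∑ j, X ⊗ₖ Y j = X ⊗ₖ ∑ j, Y j := by
  ext p q
  simp [Matrix.sum_apply, Finset.mul_sum]

lemma sum_kronecker {J : Type} [Fintype J] (X : J → Matrix A A ℂ) (Y : Matrix B B ℂ) :
    ∑ j, X j ⊗ₖ Y = (∑ j, X j) ⊗ₖ Y := by
  ext p q
  simp [Matrix.sum_apply, Finset.sum_mul]

lemma conjBy_conjBy {ι κ l : Type} [Fintype ι] [Fintype κ] [Fintype l] (M : Matrix l κ ℂ)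
    (N : Matrix κ ι ℂ) (X : Matrix ι ι ℂ) : conjBy M (conjBy N X) = conjBy (M * N) X := by
  simp only [conjBy, conjTranspose_mul, Matrix.mul_assoc]

lemma IsForwardLOCC.isSeparable
    {T : Matrix (A × B) (A × B) ℂ → Matrix (A' × B') (A' × B') ℂ} (h : IsForwardLOCC T) :
    IsSeparable T := by
  obtain ⟨k, l, K, L, hK, hL, hT⟩ := h
  refine ⟨Fin k × Fin l, inferInstance, fun p => K p.1, fun p => L p.1 p.2, ?_, fun X => ?_⟩
  · simp only [kronecker_conjTranspose_mul_self, Fintype.sum_prod_type, kronecker_sum]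
    simp only [fun x => show ∑ y, (L x y)ᴴ * L x y = 1 from hL x, sum_kronecker]
    rw [show ∑ x, (K x)ᴴ * K x = 1 from hK, one_kronecker_one]
  · rw [hT, Fintype.sum_prod_type]

lemma IsBackwardLOCC.isSeparable
    {T : Matrix (A × B) (A × B) ℂ → Matrix (A' × B') (A' × B') ℂ} (h : IsBackwardLOCC T) :
    IsSeparable T := by
  obtain ⟨k, l, L, K, hL, hK, hT⟩ := h
  refine ⟨Fin l × Fin k, inferInstance, fun p => K p.1 p.2, fun p => L p.1, ?_, fun X => ?_⟩
  · simp only [kronecker_conjTranspose_mul_self, Fintype.sum_prod_type, sum_kronecker]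
    simp only [fun y => show ∑ x, (K y x)ᴴ * K y x = 1 from hK y, kronecker_sum]
    rw [show ∑ x, (L x)ᴴ * L x = 1 from hL, one_kronecker_one]
  · rw [hT, Fintype.sum_prod_type]

/-- The inductive step for two-way protocols: Kraus families multiply along each branch. A round by
one party is the case where the other factor is the identity. -/
lemma isSeparable_comp {A₁ B₁ : Type} [Fintype A₁] [DecidableEq A₁] [Fintype B₁] [DecidableEq B₁]
    {k : ℕ} {K : Fin k → Matrix A₁ A ℂ} {L : Fin k → Matrix B₁ B ℂ}
    (h : ∑ x, (K x ⊗ₖ L x)ᴴ * (K x ⊗ₖ L x) = 1)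
    {T : Fin k → Matrix (A₁ × B₁) (A₁ × B₁) ℂ → Matrix (A' × B') (A' × B') ℂ}
    (hT : ∀ x, IsSeparable (T x)) :
    IsSeparable fun X : Matrix (A × B) (A × B) ℂ => ∑ x, T x (conjBy (K x ⊗ₖ L x) X) := by
  choose J hJ K' L' hKL hT' using hT
  refine ⟨Σ x, J x, inferInstance, fun p => K' p.1 p.2 * K p.1, fun p => L' p.1 p.2 * L p.1,
    ?_, fun X => ?_⟩
  · rw [Fintype.sum_sigma, ← h]
    refine Finset.sum_congr rfl fun x _ => ?_
    simp only [mul_kronecker_mul, conjTranspose_mul]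
    calc _ = ∑ j, (K x ⊗ₖ L x)ᴴ * ((K' x j ⊗ₖ L' x j)ᴴ * (K' x j ⊗ₖ L' x j)) * (K x ⊗ₖ L x) :=
          Finset.sum_congr rfl fun j _ => by simp only [Matrix.mul_assoc]
      _ = _ := by rw [← Matrix.sum_mul, ← Matrix.mul_sum, hKL x, Matrix.mul_one]
  · rw [Fintype.sum_sigma]
    refine Finset.sum_congr rfl fun x _ => ?_
    rw [hT' x]
    exact Finset.sum_congr rfl fun j _ => by rw [conjBy_conjBy, mul_kronecker_mul]

lemma IsTwoWayLOCC.isSeparable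
    {T : Matrix (A × B) (A × B) ℂ → Matrix (A' × B') (A' × B') ℂ} (h : IsTwoWayLOCC T) :
    IsSeparable T := by
  induction h with
  | localOps K L hK hL =>
    exact IsForwardLOCC.isSeparable ⟨_, _, K, fun _ => L, hK, fun _ => hL, fun _ => rfl⟩
  | roundA K hK T _ ih =>
    refine isSeparable_comp ?_ ih
    simp only [kronecker_conjTranspose_mul_self, sum_kronecker]
    rw [show ∑ x, (K x)ᴴ * K x = 1 from hK]; simp
  | roundB L hL T _ ih =>
    refine isSeparable_comp ?_ ih
    simp only [kronecker_conjTranspose_mul_self, kronecker_sum]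
    rw [show ∑ x, (L x)ᴴ * L x = 1 from hL]; simp

lemma IsLOCC.isSeparable {c : CommClass}
    {T : Matrix (A × B) (A × B) ℂ → Matrix (A' × B') (A' × B') ℂ} (h : IsLOCC c T) :
    IsSeparable T := by
  cases c
  · exact IsForwardLOCC.isSeparable h
  · exact IsBackwardLOCC.isSeparable h
  · exact IsTwoWayLOCC.isSeparable h

end Kraus

/-! ### Converse bounds -/

section Converse

variable {A B : Type} [Fintype A] [DecidableEq A] [Fintype B] [DecidableEq B]

lemma coeffMatrix_maxEntangled (M : ℕ) :
    coeffMatrix (maxEntangled M) = ((1 / Real.sqrt M : ℝ) : ℂ) • (1 : Matrix (Fin M) (Fin M) ℂ) := by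
  ext i j
  by_cases h : i = j <;> simp [coeffMatrix, maxEntangled, h]

lemma coeffMatrix_maxEntangled_gram (M : ℕ) :
    coeffMatrix (maxEntangled M) * (coeffMatrix (maxEntangled M))ᴴ =
      ((1 / M : ℝ) : ℂ) • (1 : Matrix (Fin M) (Fin M) ℂ) := by
  rw [coeffMatrix_maxEntangled, conjTranspose_smul, Matrix.smul_mul, Matrix.mul_smul, smul_smul]
  congr 1
  · rw [RCLike.star_def, Complex.conj_ofReal, ← Complex.ofReal_mul, div_mul_div_comm,
      Real.mul_self_sqrt (Nat.cast_nonneg M), one_mul]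
  · simp

lemma frobSq_maxEntangled {M : ℕ} (hM : 1 ≤ M) : frobSq (coeffMatrix (maxEntangled M)) = 1 := by
  have : (M : ℝ) ≠ 0 := by positivity
  rw [← re_trace_mul_conjTranspose, coeffMatrix_maxEntangled_gram]
  simp [this]

/-- Each branch has rank at most M. Its squared overlap with φ is therefore at most its weight times
Tr Pρ for a projection P of rank at most M, and Tr Pρ ≤ excess + q Tr P. The weights sum to 1. -/
lemma dilution_fidelity_le {φ : EuclideanSpace ℂ (A × B)} {M : ℕ} (hM : 1 ≤ M)
    {T : Matrix (Fin M × Fin M) (Fin M × Fin M) ℂ → Matrix (A × B) (A × B) ℂ}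
    (hT : IsSeparable T) {q : ℝ} (hq : 0 ≤ q) :
    fidelity φ (T (ketBra (maxEntangled M))) ≤ excess (reducedA (ketBra φ)) q + M * q := by
  obtain ⟨J, _, K, L, hKL, hTX⟩ := hT
  rw [hTX, fidelity_sum]
  set Ψ := coeffMatrix (maxEntangled M)
  set Φ := coeffMatrix φ
  have hH : (Φ * Φᴴ).IsHermitian := isHermitian_mul_conjTranspose_self Φ
  have key : ∀ j, fidelity φ (conjBy (K j ⊗ₖ L j) (ketBra (maxEntangled M))) ≤
      (excess (Φ * Φᴴ) q + M * q) * frobSq (K j * Ψ * (L j)ᵀ) := by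
    intro j
    rw [fidelity_conjBy]
    obtain ⟨P, hP, hPr, hPX⟩ := exists_rangeProj (K j * Ψ * (L j)ᵀ)
    refine (norm_trace_sq_le_of_proj hP hPX).trans ?_
    refine mul_le_mul_of_nonneg_right ?_ (frobSq_nonneg _)
    have h1 := hP.trace_mul_le_excess hH q
    have h2 : (K j * Ψ * (L j)ᵀ).rank ≤ M := by
      rw [Matrix.mul_assoc]
      refine (rank_mul_le_right _ _).trans ((rank_le_card_height _).trans ?_)
      simp
    have h3 : q * P.trace.re ≤ M * q := by
      rw [hPr, mul_comm]
      exact mul_le_mul_of_nonneg_right (Nat.cast_le.2 h2) hq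
    linarith
  refine (Finset.sum_le_sum fun j _ => key j).trans ?_
  rw [← Finset.mul_sum, sum_frobSq_of_kraus hKL, frobSq_maxEntangled hM, mul_one]
  rfl

/-- Φ is split by the spectral projection P = {ρ ≥ q}. The branches of PΦ have rank at most 1/q,
hence total fidelity at most 1/(Mq) ≤ a² with Ψ_M; the remainder has weight 1 - p with p ≥ excess.
The free parameter `a` lets callers make the error terms decay. -/
lemma distillation_excess_le {φ : EuclideanSpace ℂ (A × B)} (hφ : ‖φ‖ = 1) {M : ℕ} (hM : 1 ≤ M)
    {T : Matrix (A × B) (A × B) ℂ → Matrix (Fin M × Fin M) (Fin M × Fin M) ℂ}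
    (hT : IsSeparable T) {q a : ℝ} (hq : 0 < q) (ha : 0 ≤ a) (haq : 1 ≤ a ^ 2 * (M * q)) :
    excess (reducedA (ketBra φ)) q ≤
      1 - fidelity (maxEntangled M) (T (ketBra φ)) + a ^ 2 + 2 * a := by
  obtain ⟨J, _, K, L, hKL, hTX⟩ := hT
  rw [hTX, fidelity_sum]
  simp only [fidelity_conjBy]
  set Ψ := coeffMatrix (maxEntangled M) with hΨ
  set Φ := coeffMatrix φ with hΦ
  have hH : (Φ * Φᴴ).IsHermitian := isHermitian_mul_conjTranspose_self Φ
  have hΦ1 : frobSq Φ = 1 := by rw [frobSq_coeffMatrix, hφ, one_pow]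
  have hM0 : (0 : ℝ) < M := by exact_mod_cast hM
  obtain ⟨P, hP, hPr, hPe⟩ := exists_spectralProj hH q
  set p := (P * (Φ * Φᴴ)).trace.re with hp
  have hpn : 0 ≤ p := by rw [hp, ← hP.frobSq_mul]; exact frobSq_nonneg _
  have hp1 : frobSq ((1 - P) * Φ) = 1 - p := by
    rw [hP.one_sub.frobSq_mul, Matrix.sub_mul, Matrix.one_mul, trace_sub, Complex.sub_re,
      re_trace_mul_conjTranspose, hΦ1]
  have hp1' : 0 ≤ 1 - p := hp1 ▸ frobSq_nonneg _
  have hPt : 0 ≤ P.trace.re := (Nat.cast_nonneg _).trans hPr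
  have hex : excess (Φ * Φᴴ) q ≤ p := by
    have := mul_nonneg hq.le hPt
    linarith
  have hrq : q * P.rank ≤ 1 := by
    have h1 := mul_le_mul_of_nonneg_left hPr hq.le
    have h2 : 0 ≤ excess (Φ * Φᴴ) q := (isState_gram hΦ1).excess_nonneg q
    linarith
  set α : J → ℂ := fun j => (Ψᴴ * (K j * (P * Φ) * (L j)ᵀ)).trace with hα
  set β : J → ℂ := fun j => (Ψᴴ * (K j * ((1 - P) * Φ) * (L j)ᵀ)).trace with hβ
  have hαβ : ∀ j, (Ψᴴ * (K j * Φ * (L j)ᵀ)).trace = α j + β j := by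
    intro j
    rw [hα, hβ, ← trace_add, ← Matrix.mul_add, ← Matrix.add_mul, ← Matrix.mul_add,
      ← Matrix.add_mul, add_sub_cancel, Matrix.one_mul]
  have hαs : ∑ j, ‖α j‖ ^ 2 ≤ a ^ 2 := by
    have key : ∀ j, ‖α j‖ ^ 2 ≤ (P.rank / M : ℝ) * frobSq (K j * (P * Φ) * (L j)ᵀ) := by
      intro j
      obtain ⟨Q, hQ, hQr, hQX⟩ := exists_rangeProj (K j * (P * Φ) * (L j)ᵀ)
      refine (norm_trace_sq_le_of_proj hQ hQX).trans ?_
      refine mul_le_mul_of_nonneg_right ?_ (frobSq_nonneg _)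
      rw [hΨ, coeffMatrix_maxEntangled_gram, Matrix.mul_smul, Matrix.mul_one, trace_smul,
        smul_eq_mul, Complex.re_ofReal_mul, hQr, div_mul_eq_mul_div, one_mul]
      have : (K j * (P * Φ) * (L j)ᵀ).rank ≤ P.rank :=
        (rank_mul_le_left _ _).trans ((rank_mul_le_right _ _).trans (rank_mul_le_left _ _))
      gcongr
    refine (Finset.sum_le_sum fun j _ => key j).trans ?_
    rw [← Finset.mul_sum, sum_frobSq_of_kraus hKL, hP.frobSq_mul]
    have h1 : (P.rank / M : ℝ) ≤ a ^ 2 := by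
      rw [div_le_iff₀ hM0]
      have h2 : q * P.rank ≤ q * (a ^ 2 * M) := by linarith
      exact le_of_mul_le_mul_left h2 hq
    calc (P.rank / M : ℝ) * p ≤ a ^ 2 * 1 := by gcongr; linarith
      _ = a ^ 2 := mul_one _
  have hβs : ∑ j, ‖β j‖ ^ 2 ≤ 1 - p := by
    rw [← hp1, ← sum_frobSq_of_kraus hKL ((1 - P) * Φ)]
    refine Finset.sum_le_sum fun j _ => (norm_trace_sq_le _ _).trans ?_
    rw [hΨ, frobSq_maxEntangled hM, one_mul]
  -- Cauchy–Schwarz over the branches; the β-part has total weight at most 1.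
  have hcs : ∑ j, ‖α j‖ * ‖β j‖ ≤ a := by
    refine le_of_sq_le_sq ?_ ha
    refine (Finset.sum_mul_sq_le_sq_mul_sq _ _ _).trans ?_
    calc (∑ j, ‖α j‖ ^ 2) * ∑ j, ‖β j‖ ^ 2 ≤ a ^ 2 * 1 := by
          gcongr; linarith
      _ = a ^ 2 := mul_one _
  have hF : ∑ j, ‖(Ψᴴ * (K j * Φ * (L j)ᵀ)).trace‖ ^ 2 ≤ a ^ 2 + 2 * a + (1 - p) := by
    calc _ ≤ ∑ j, (‖α j‖ ^ 2 + 2 * (‖α j‖ * ‖β j‖) + ‖β j‖ ^ 2) := by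
          refine Finset.sum_le_sum fun j _ => ?_
          rw [hαβ]
          have := pow_le_pow_left₀ (norm_nonneg _) (norm_add_le (α j) (β j)) 2
          linarith [add_sq ‖α j‖ ‖β j‖]
      _ ≤ _ := by
          rw [Finset.sum_add_distrib, Finset.sum_add_distrib, ← Finset.mul_sum]
          linarith
  rw [reducedA_ketBra, ← hΦ]
  linarith

end Converse

/-! ### One-way protocols -/

section OneWay

variable {A B A' B' : Type} [Fintype A] [DecidableEq A] [Fintype B] [DecidableEq B]
  [Fintype A'] [DecidableEq A'] [Fintype B'] [DecidableEq B']

/-- A one-way protocol takes the vector with coefficient matrix `Φ` to the one with coefficient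
matrix `Ψ` with fidelity at least `F`. -/
def OneWayAchieves (Φ : Matrix A B ℂ) (Ψ : Matrix A' B' ℂ) (F : ℝ) : Prop :=
  ∃ (J I : Type) (_ : Fintype J) (_ : Fintype I) (K : J → Matrix A' A ℂ)
    (L : J → I → Matrix B' B ℂ), ∑ x, (K x)ᴴ * K x = 1 ∧ (∀ x, ∑ y, (L x y)ᴴ * L x y = 1) ∧
    F ≤ ∑ x, ∑ y, ‖(Ψᴴ * (K x * Φ * (L x y)ᵀ)).trace‖ ^ 2

lemma OneWayAchieves.exists_fin {Φ : Matrix A B ℂ} {Ψ : Matrix A' B' ℂ} {F : ℝ}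
    (h : OneWayAchieves Φ Ψ F) :
    ∃ (k l : ℕ) (K : Fin k → Matrix A' A ℂ) (L : Fin k → Fin l → Matrix B' B ℂ),
      IsKraus K ∧ (∀ x, IsKraus (L x)) ∧
      F ≤ ∑ x, ∑ y, ‖(Ψᴴ * (K x * Φ * (L x y)ᵀ)).trace‖ ^ 2 := by
  obtain ⟨J, I, _, _, K, L, hK, hL, hF⟩ := h
  let e := (Fintype.equivFin J).symm
  let e' := (Fintype.equivFin I).symm
  refine ⟨_, _, fun x => K (e x), fun x y => L (e x) (e' y), ?_, fun x => ?_, ?_⟩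
  · rw [IsKraus, e.sum_comp fun x => (K x)ᴴ * K x, hK]
  · rw [IsKraus, e'.sum_comp fun y => (L (e x) y)ᴴ * L (e x) y, hL]
  · rw [e.sum_comp fun x => ∑ y, ‖(Ψᴴ * (K x * Φ * (L x (e' y))ᵀ)).trace‖ ^ 2]
    refine hF.trans (le_of_eq (Finset.sum_congr rfl fun x _ => ?_))
    rw [e'.sum_comp fun y => ‖(Ψᴴ * (K x * Φ * (L x y)ᵀ)).trace‖ ^ 2]

lemma OneWayAchieves.forward {φ : EuclideanSpace ℂ (A × B)} {ψ : EuclideanSpace ℂ (A' × B')}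
    {F : ℝ} (h : OneWayAchieves (coeffMatrix φ) (coeffMatrix ψ) F) :
    ∃ T, IsForwardLOCC T ∧ F ≤ fidelity ψ (T (ketBra φ)) := by
  obtain ⟨k, l, K, L, hK, hL, hF⟩ := h.exists_fin
  refine ⟨fun X => ∑ x, ∑ y, conjBy (K x ⊗ₖ L x y) X, ⟨k, l, K, L, hK, hL, fun _ => rfl⟩, ?_⟩
  simpa only [fidelity_sum, fidelity_conjBy] using hF

/-- Transposing the coefficient matrices exchanges the two parties, so protocols need only be built
in one direction. -/
lemma OneWayAchieves.backward {φ : EuclideanSpace ℂ (A × B)} {ψ : EuclideanSpace ℂ (A' × B')}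
    {F : ℝ} (h : OneWayAchieves (coeffMatrix φ)ᵀ (coeffMatrix ψ)ᵀ F) :
    ∃ T, IsBackwardLOCC T ∧ F ≤ fidelity ψ (T (ketBra φ)) := by
  obtain ⟨k, l, K, L, hK, hL, hF⟩ := h.exists_fin
  refine ⟨fun X => ∑ x, ∑ y, conjBy (L x y ⊗ₖ K x) X, ⟨l, k, K, L, hK, hL, fun _ => rfl⟩, ?_⟩
  simp only [fidelity_sum, fidelity_conjBy]
  refine hF.trans (le_of_eq (Finset.sum_congr rfl fun x _ => Finset.sum_congr rfl fun y _ => ?_))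
  congr 2
  rw [← trace_transpose, transpose_mul, transpose_mul (K x * _), transpose_mul (K x),
    transpose_transpose, transpose_transpose, ← Matrix.mul_assoc, trace_mul_comm]
  rfl

/-- One round by A, after which A applies the identity and B the announced operation. -/
lemma IsForwardLOCC.isTwoWayLOCC
    {T : Matrix (A × B) (A × B) ℂ → Matrix (A' × B') (A' × B') ℂ} (h : IsForwardLOCC T) :
    IsTwoWayLOCC T := by
  obtain ⟨k, l, K, L, hK, hL, hT⟩ := h
  have h1 : IsKraus (fun _ : Fin 1 => (1 : Matrix A' A' ℂ)) := by simp [IsKraus]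
  have h2 := IsTwoWayLOCC.roundA K hK _ fun x => IsTwoWayLOCC.localOps _ (L x) h1 (hL x)
  convert h2 using 1
  funext X
  simp only [hT, Finset.univ_unique, Finset.sum_singleton, conjBy_conjBy, ← mul_kronecker_mul,
    Matrix.one_mul, Matrix.mul_one]

lemma exists_isLOCC (c : CommClass) {φ : EuclideanSpace ℂ (A × B)}
    {ψ : EuclideanSpace ℂ (A' × B')} {F : ℝ}
    (h : OneWayAchieves (coeffMatrix φ) (coeffMatrix ψ) F)
    (h' : OneWayAchieves (coeffMatrix φ)ᵀ (coeffMatrix ψ)ᵀ F) :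
    ∃ T, IsLOCC c T ∧ F ≤ fidelity ψ (T (ketBra φ)) := by
  cases c
  · exact h.forward
  · exact h'.backward
  · obtain ⟨T, hT, hF⟩ := h.forward
    exact ⟨T, hT.isTwoWayLOCC, hF⟩

end OneWay

/-! ### Distillation -/

section Distillation

variable {A B : Type} [Fintype A] [DecidableEq A] [Fintype B] [DecidableEq B]

lemma sum_sign_mul_sign (i j : A) :
    ∑ s : A → ℤˣ, ((s i : ℤ) : ℂ) * ((s j : ℤ) : ℂ) =
      if i = j then (Fintype.card (A → ℤˣ) : ℂ) else 0 := by
  split_ifs with h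
  · subst h
    simp [← Int.cast_mul, ← Units.val_mul]
  -- Flipping the sign at i is a bijection of the sign vectors that negates every term when i ≠ j,
  -- so the sum equals its own negative.
  · have := Equiv.sum_comp (Equiv.mulRight (Pi.mulSingle i (-1) : A → ℤˣ))
      fun s : A → ℤˣ => ((s i : ℤ) : ℂ) * ((s j : ℤ) : ℂ)
    simp only [Equiv.coe_mulRight, Pi.mul_apply, Pi.mulSingle_eq_same,
      Pi.mulSingle_eq_of_ne (Ne.symm h), mul_one, mul_neg, Units.val_neg, Int.cast_neg, neg_mul,
      Finset.sum_neg_distrib] at this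
    linear_combination (-1 / 2 : ℂ) * this

/-- The diagonal matrix of a vector of signs. -/
def signMatrix (s : A → ℤˣ) : Matrix A A ℂ := diagonal fun i => ((s i : ℤ) : ℂ)

lemma signMatrix_conjTranspose (s : A → ℤˣ) : (signMatrix s)ᴴ = signMatrix s := by
  rw [signMatrix, diagonal_conjTranspose]
  congr 1; funext i; simp

lemma signMatrix_mul_diagonal_mul (s : A → ℤˣ) (d : A → ℂ) :
    signMatrix s * diagonal d * signMatrix s = diagonal d := by
  rw [signMatrix, diagonal_mul_diagonal, diagonal_mul_diagonal]
  congr 1; funext i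
  rw [mul_right_comm, ← Int.cast_mul, ← Units.val_mul]; simp

/-- Averaging over random signs erases the off-diagonal entries; this is what makes the binning
measurement below complete. -/
lemma sum_signMatrix_conj (G : Matrix A A ℂ) :
    ∑ s : A → ℤˣ, signMatrix s * G * signMatrix s =
      (Fintype.card (A → ℤˣ) : ℂ) • diagonal fun i => G i i := by
  ext i j
  simp only [Matrix.sum_apply, signMatrix, mul_diagonal, diagonal_mul, Matrix.smul_apply,
    smul_eq_mul]
  calc _ = (∑ s : A → ℤˣ, ((s i : ℤ) : ℂ) * ((s j : ℤ) : ℂ)) * G i j := by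
        rw [Finset.sum_mul]; exact Finset.sum_congr rfl fun s _ => by ring
    _ = _ := by
        rw [sum_sign_mul_sign]
        by_cases h : i = j <;> simp [h]

/-- A co-isometry is part of a complete family of Kraus operators. -/
lemma exists_kraus_completion {M : ℕ} (hM : 1 ≤ M) {L : Matrix (Fin M) B ℂ} (hL : L * Lᴴ = 1) :
    ∃ K : Option B → Matrix (Fin M) B ℂ, K none = L ∧ ∑ y, (K y)ᴴ * K y = 1 := by
  have hP : IsOrthProj (Lᴴ * L) := ⟨isHermitian_conjTranspose_mul_self L, by
    rw [Matrix.mul_assoc, ← Matrix.mul_assoc L, hL, Matrix.one_mul]⟩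
  set Q := 1 - Lᴴ * L with hQd
  have hQ : IsOrthProj Q := hP.one_sub
  -- The missing weight Q = 1 - LᴴL is a projection. Each of its rows becomes a Kraus operator with
  -- output in the zeroth basis vector, and these contribute QᴴQ = Q.
  refine ⟨fun y => y.elim L fun j => of fun b b' => if b = ⟨0, hM⟩ then Q j b' else 0, rfl, ?_⟩
  rw [Fintype.sum_option]
  have : ∑ j : B, (of fun (b : Fin M) b' => if b = ⟨0, hM⟩ then Q j b' else 0)ᴴ *
      (of fun (b : Fin M) b' => if b = ⟨0, hM⟩ then Q j b' else 0) = Qᴴ * Q := by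
    ext a b
    simp [Matrix.sum_apply, mul_apply, conjTranspose_apply, apply_ite star]
  simp only [Option.elim]
  rw [this, hQ.isHermitian, hQ.mul_self, hQd]
  simp

lemma trace_maxEntangled_mul (M : ℕ) (X : Matrix (Fin M) (Fin M) ℂ) :
    ((coeffMatrix (maxEntangled M))ᴴ * X).trace = ((1 / Real.sqrt M : ℝ) : ℂ) * X.trace := by
  rw [coeffMatrix_maxEntangled, conjTranspose_smul, conjTranspose_one, Matrix.smul_mul,
    Matrix.one_mul, trace_smul, RCLike.star_def, Complex.conj_ofReal, smul_eq_mul]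

/-- Alice coherently merges the Schmidt vectors of each bin after applying random signs, which are
the announced outcome. In every branch the merged matrix G satisfies GGᴴ = diag(W), with W the bin
weights, since bins are disjoint and signs square to 1. Bob's co-isometry turns the branch into a
multiple of diag(√W), whose overlap with Ψ_M is large because each W is at least c. -/
lemma oneWayAchieves_of_bins (Φ : Matrix A B ℂ) {H : Matrix A A ℂ} (hH : H.IsHermitian)
    (hHΦ : H = Φ * Φᴴ) {M : ℕ} (hM : 1 ≤ M) (f : A → Fin M) {c : ℝ} (hc : 0 < c)
    (hf : ∀ b, c ≤ ∑ i with f i = b, hH.eigenvalues i) :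
    OneWayAchieves Φ (coeffMatrix (maxEntangled M)) (M * c) := by
  set U : Matrix A A ℂ := (hH.eigenvectorUnitary : Matrix A A ℂ) with hU
  have hUU : Uᴴ * U = 1 := conjTranspose_mul_eigenvectorUnitary hH
  have hUU' : U * Uᴴ = 1 := eigenvectorUnitary_mul_conjTranspose hH
  set lam := hH.eigenvalues with hlam
  set W : Fin M → ℝ := fun b => ∑ i with f i = b, lam i with hW
  have hWpos : ∀ b, 0 < W b := fun b => hc.trans_le (hf b)
  set N : ℕ := Fintype.card (A → ℤˣ) with hN
  have hNpos : (0 : ℝ) < N := by exact_mod_cast Fintype.card_pos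
  set F : Matrix (Fin M) A ℂ := of fun b i => if f i = b then 1 else 0 with hF
  set r : ℂ := ((1 / Real.sqrt N : ℝ) : ℂ) with hr
  have hrr : star r * r = (1 / N : ℂ) := by
    rw [hr, RCLike.star_def, Complex.conj_ofReal, ← Complex.ofReal_mul, div_mul_div_comm,
      Real.mul_self_sqrt hNpos.le]
    simp
  set R : Matrix A B ℂ := Uᴴ * Φ with hR
  have hRR : R * Rᴴ = diagonal fun i => (lam i : ℂ) := by
    rw [hR, conjTranspose_mul, conjTranspose_conjTranspose]
    calc Uᴴ * Φ * (Φᴴ * U) = Uᴴ * (Φ * Φᴴ) * U := by simp only [Matrix.mul_assoc]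
      _ = Uᴴ * (U * diagonal (fun i => (lam i : ℂ)) * Uᴴ) * U := by
        rw [← hHΦ]; congr 2; exact spectral_decomposition hH
      _ = (Uᴴ * U) * diagonal (fun i => (lam i : ℂ)) * (Uᴴ * U) := by
        simp only [Matrix.mul_assoc]
      _ = _ := by rw [hUU, Matrix.one_mul, Matrix.mul_one]
  set G : (A → ℤˣ) → Matrix (Fin M) B ℂ := fun s => F * signMatrix s * R with hG
  have hGG : ∀ s, G s * (G s)ᴴ = diagonal fun b => (W b : ℂ) := by
    intro s
    calc G s * (G s)ᴴ = F * (signMatrix s * (R * Rᴴ) * signMatrix s) * Fᴴ := by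
          simp only [hG, conjTranspose_mul, signMatrix_conjTranspose, Matrix.mul_assoc]
      _ = F * diagonal (fun i => (lam i : ℂ)) * Fᴴ := by
          rw [hRR, signMatrix_mul_diagonal_mul]
      _ = _ := by
          ext b b'
          rw [mul_apply, diagonal_apply]
          simp only [mul_diagonal, conjTranspose_apply, hF, of_apply]
          split_ifs with h
          · subst h
            rw [hW]
            push_cast
            rw [Finset.sum_filter]
            exact Finset.sum_congr rfl fun i _ => by split_ifs <;> simp
          · refine Finset.sum_eq_zero fun i _ => ?_
            by_cases h1 : f i = b
            · rw [if_neg (fun h2 => h (h1.symm.trans h2))]; simp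
            · rw [if_neg h1]; simp
  clear_value G
  set D : Matrix (Fin M) (Fin M) ℂ := diagonal fun b => ((1 / Real.sqrt (W b) : ℝ) : ℂ) with hD
  have hDh : Dᴴ = D := by
    rw [hD, diagonal_conjTranspose]; congr 1; funext b; simp
  have hDt : Dᵀ = D := diagonal_transpose _
  have hGD : ∀ s, G s * (G s)ᴴ * D = diagonal fun b => ((Real.sqrt (W b) : ℝ) : ℂ) := by
    intro s
    rw [hGG, hD, diagonal_mul_diagonal]
    congr 1; funext b
    rw [← Complex.ofReal_mul, mul_one_div, Real.div_sqrt]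
  have hL : ∀ s, (D * (G s)ᴴᵀ) * (D * (G s)ᴴᵀ)ᴴ = 1 := by
    intro s
    have h1 : (D * (G s)ᴴᵀ) * (D * (G s)ᴴᵀ)ᴴ = (D * (G s * (G s)ᴴ * D))ᵀ := by
      have h2 : D * (G s)ᴴᵀ = ((G s)ᴴ * D)ᵀ := by rw [transpose_mul, hDt]
      have h3 : ((G s)ᴴ * D)ᴴ = D * G s := by
        rw [conjTranspose_mul, hDh, conjTranspose_conjTranspose]
      rw [h2]
      refine (transpose_mul ((G s)ᴴ * D)ᴴ ((G s)ᴴ * D)).symm.trans ?_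
      rw [h3]
      simp only [Matrix.mul_assoc]
    rw [h1, hGD, hD, diagonal_mul_diagonal, diagonal_transpose, ← diagonal_one]
    congr 1; funext b
    rw [← Complex.ofReal_mul, one_div_mul_cancel (Real.sqrt_pos.2 (hWpos b)).ne', Complex.ofReal_one]
  choose Lc hLc0 hLc using fun s => exists_kraus_completion hM (hL s)
  refine ⟨A → ℤˣ, Option B, inferInstance, inferInstance,
    fun s => r • (F * signMatrix s * Uᴴ), Lc, ?_, hLc, ?_⟩
  · have h1 : ∀ s : A → ℤˣ, (r • (F * signMatrix s * Uᴴ))ᴴ * (r • (F * signMatrix s * Uᴴ)) =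
        (1 / N : ℂ) • (U * (signMatrix s * (Fᴴ * F) * signMatrix s) * Uᴴ) := by
      intro s
      rw [conjTranspose_smul, Matrix.smul_mul, Matrix.mul_smul, smul_smul, hrr]
      simp only [conjTranspose_mul, conjTranspose_conjTranspose, signMatrix_conjTranspose,
        Matrix.mul_assoc]
    -- Every index lies in exactly one bin, so FᴴF has unit diagonal, and the sign average keeps
    -- only that diagonal.
    have h2 : (fun i => (Fᴴ * F) i i) = fun _ => (1 : ℂ) := by
      funext i
      simp [mul_apply, hF]
    simp only [h1]
    rw [← Finset.smul_sum, ← Matrix.sum_mul, ← Matrix.mul_sum, sum_signMatrix_conj, h2,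
      diagonal_one, Matrix.mul_smul, Matrix.smul_mul, Matrix.mul_one, hUU', smul_smul, ← hN,
      one_div_mul_cancel (by exact_mod_cast hNpos.ne'), one_smul]
  · have h1 : ∀ s : A → ℤˣ, (M * c) / N ≤ ∑ y, ‖((coeffMatrix (maxEntangled M))ᴴ *
        (r • (F * signMatrix s * Uᴴ) * Φ * (Lc s y)ᵀ)).trace‖ ^ 2 := by
      intro s
      -- Only Bob's co-isometry outcome is counted; the completing outcomes can only raise the
      -- fidelity.
      refine le_trans ?_ (Finset.single_le_sum (fun y _ => by positivity) (Finset.mem_univ none))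
      have h2 : r • (F * signMatrix s * Uᴴ) * Φ * (Lc s none)ᵀ =
          r • diagonal fun b => ((Real.sqrt (W b) : ℝ) : ℂ) := by
        rw [hLc0, ← hGD s, transpose_mul, hDt, Matrix.smul_mul, Matrix.smul_mul]
        simp only [hG, hR, transpose_transpose, Matrix.mul_assoc]
      rw [h2, trace_maxEntangled_mul, trace_smul, trace_diagonal, smul_eq_mul, hr,
        ← Complex.ofReal_sum, ← Complex.ofReal_mul, ← Complex.ofReal_mul, Complex.norm_real,
        Real.norm_eq_abs, sq_abs, mul_pow, mul_pow, div_pow, div_pow, Real.sq_sqrt hNpos.le,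
        Real.sq_sqrt (Nat.cast_nonneg M), one_pow]
      have hM0 : (0 : ℝ) < M := by exact_mod_cast hM
      have h3 : (M : ℝ) * Real.sqrt c ≤ ∑ b, Real.sqrt (W b) := by
        calc (M : ℝ) * Real.sqrt c = ∑ _b : Fin M, Real.sqrt c := by simp
          _ ≤ _ := Finset.sum_le_sum fun b _ => Real.sqrt_le_sqrt (hf b)
      have h4 := pow_le_pow_left₀ (by positivity) h3 2
      rw [mul_pow, Real.sq_sqrt hc.le] at h4
      calc (M * c) / N = 1 / M * (1 / N * (M ^ 2 * c)) := by field_simp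
        _ ≤ _ := by gcongr
    refine le_trans ?_ (Finset.sum_le_sum fun s _ => h1 s)
    rw [Finset.sum_const, Finset.card_univ, ← hN, nsmul_eq_mul, mul_div_cancel₀ _ hNpos.ne']

/-- Greedy filling: indices are added one at a time until the weight first reaches c, so the last
one overshoots by at most q. -/
lemma exists_subset_sum_mem {ι : Type} [DecidableEq ι] {μ : ι → ℝ} {q c : ℝ}
    (hμq : ∀ i, μ i ≤ q) (hq : 0 ≤ q) (hc : 0 ≤ c) (s : Finset ι) (h : c ≤ ∑ i ∈ s, μ i) :
    ∃ t ⊆ s, c ≤ ∑ i ∈ t, μ i ∧ ∑ i ∈ t, μ i ≤ c + q := by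
  induction s using Finset.induction_on with
  | empty => exact ⟨∅, subset_rfl, h, by simpa using add_nonneg hc hq⟩
  | insert a s ha ih =>
    by_cases h1 : c ≤ ∑ i ∈ s, μ i
    · obtain ⟨t, ht, h2⟩ := ih h1
      exact ⟨t, ht.trans (Finset.subset_insert a s), h2⟩
    · refine ⟨insert a s, subset_rfl, h, ?_⟩
      rw [Finset.sum_insert ha]
      linarith [hμq a]

/-- Small weights can be collected into bins of prescribed weight. -/
lemma exists_bins {ι : Type} [DecidableEq ι] {μ : ι → ℝ} {q c : ℝ} (hμ : ∀ i, 0 ≤ μ i)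
    (hμq : ∀ i, μ i ≤ q) (hq : 0 ≤ q) (hc : 0 ≤ c) (M : ℕ) (s : Finset ι)
    (h : M * (c + q) ≤ ∑ i ∈ s, μ i) :
    ∃ f : ι → ℕ, ∀ b < M, c ≤ ∑ i ∈ s with f i = b, μ i := by
  induction M generalizing s with
  | zero => exact ⟨fun _ => 0, fun b hb => absurd hb (Nat.not_lt_zero b)⟩
  | succ M ih =>
    have hM : (0 : ℝ) ≤ M * (c + q) := by positivity
    push_cast at h
    obtain ⟨t, ht, h1, h2⟩ := exists_subset_sum_mem hμq hq hc s (by linarith)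
    have h3 := Finset.sum_sdiff ht (f := μ)
    obtain ⟨f, hf⟩ := ih (s \ t) (by linarith)
    -- The filled set t becomes the new bin `M`. It uses at most c + q, which leaves enough weight
    -- for the other M bins.
    refine ⟨fun i => if i ∈ t then M else f i, fun b hb => ?_⟩
    rcases Nat.lt_succ_iff_lt_or_eq.1 hb with hb | rfl
    · refine (hf b hb).trans (Finset.sum_le_sum_of_subset_of_nonneg ?_ fun i _ _ => hμ i)
      intro i hi
      simp only [Finset.mem_filter, Finset.mem_sdiff] at hi ⊢
      exact ⟨hi.1.1, by rw [if_neg hi.1.2, hi.2]⟩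
    · refine h1.trans (Finset.sum_le_sum_of_subset_of_nonneg ?_ fun i _ _ => hμ i)
      intro i hi
      simp only [Finset.mem_filter]
      exact ⟨ht hi, by rw [if_pos hi]⟩

lemma exists_bins_fin {ι : Type} [Fintype ι] [DecidableEq ι] {μ : ι → ℝ} {q c : ℝ}
    (hμ : ∀ i, 0 ≤ μ i) (hμq : ∀ i, μ i ≤ q) (hq : 0 ≤ q) (hc : 0 ≤ c) {M : ℕ} (hM : 1 ≤ M)
    (h : M * (c + q) ≤ ∑ i, μ i) :
    ∃ f : ι → Fin M, ∀ b, c ≤ ∑ i with f i = b, μ i := by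
  obtain ⟨f, hf⟩ := exists_bins hμ hμq hq hc M Finset.univ h
  -- Unassigned indices are put into bin 0, where nonnegative weights do no harm.
  refine ⟨fun i => if h : f i < M then ⟨f i, h⟩ else ⟨0, hM⟩, fun b => ?_⟩
  refine (hf b b.2).trans (Finset.sum_le_sum_of_subset_of_nonneg ?_ fun i _ _ => hμ i)
  intro i hi
  simp only [Finset.mem_filter, Finset.mem_univ, true_and] at hi ⊢
  rw [dif_pos (hi ▸ b.2)]
  exact Fin.ext hi

/-- The bins are filled with the capped weights min(λ, q), of total 1 - excess. The value of c is
fixed by M(c + q) = 1 - excess, and the true eigenvalues only make the bins heavier. -/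
lemma oneWayAchieves_distillation {Φ : Matrix A B ℂ} (hΦ : frobSq Φ = 1) {M : ℕ} (hM : 1 ≤ M)
    {q : ℝ} (hq : 0 ≤ q) (h : 0 < 1 - excess (Φ * Φᴴ) q - M * q) :
    OneWayAchieves Φ (coeffMatrix (maxEntangled M)) (1 - excess (Φ * Φᴴ) q - M * q) := by
  have hs := isState_gram hΦ
  have hM0 : (0 : ℝ) < M := by exact_mod_cast hM
  set c := (1 - excess (Φ * Φᴴ) q - M * q) / M with hc
  have hcM : M * c = 1 - excess (Φ * Φᴴ) q - M * q := by rw [hc]; field_simp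
  have hc0 : 0 < c := div_pos h hM0
  obtain ⟨f, hf⟩ := exists_bins_fin (μ := fun i => min (hs.1.1.eigenvalues i) q)
    (fun i => le_min (hs.1.eigenvalues_nonneg i) hq) (fun i => min_le_right _ _) hq hc0.le hM
    (by rw [hs.sum_min, mul_add, hcM]; linarith)
  rw [← hcM]
  exact oneWayAchieves_of_bins Φ hs.1.1 rfl hM f hc0 fun b =>
    (hf b).trans (Finset.sum_le_sum fun i _ => min_le_left _ _)

/-- A single bin of weight 1. This covers the rates R ≤ 0. -/
lemma oneWayAchieves_product {Φ : Matrix A B ℂ} (hΦ : frobSq Φ = 1) :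
    OneWayAchieves Φ (coeffMatrix (maxEntangled 1)) 1 := by
  have hs := isState_gram hΦ
  have := oneWayAchieves_of_bins Φ hs.1.1 rfl le_rfl (fun _ => 0) one_pos fun b => by
    rw [Finset.filter_true_of_mem fun i _ => Subsingleton.elim _ _, hs.sum_eigenvalues]
  simpa using this

lemma transpose_coeffMatrix_maxEntangled (M : ℕ) :
    (coeffMatrix (maxEntangled M))ᵀ = coeffMatrix (maxEntangled M) := by
  rw [coeffMatrix_maxEntangled, transpose_smul, transpose_one]

lemma excess_transpose_gram (Φ : Matrix A B ℂ) {q : ℝ} (hq : 0 ≤ q) :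
    excess (Φᵀ * Φᵀᴴ) q = excess (Φ * Φᴴ) q :=
  excess_reducedB_eq (WithLp.toLp 2 fun p : A × B => Φ p.1 p.2) hq

/-- One-shot distillation. -/
lemma exists_distillation (c : CommClass) {φ : EuclideanSpace ℂ (A × B)} (hφ : ‖φ‖ = 1) {M : ℕ}
    (hM : 1 ≤ M) {q : ℝ} (hq : 0 ≤ q) (h : 0 < 1 - excess (reducedA (ketBra φ)) q - M * q) :
    ∃ T, IsLOCC c T ∧ 1 - excess (reducedA (ketBra φ)) q - M * q ≤
      fidelity (maxEntangled M) (T (ketBra φ)) := by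
  have hΦ : frobSq (coeffMatrix φ) = 1 := by rw [frobSq_coeffMatrix, hφ, one_pow]
  rw [reducedA_ketBra] at h ⊢
  refine exists_isLOCC c (oneWayAchieves_distillation hΦ hM hq h) ?_
  rw [transpose_coeffMatrix_maxEntangled]
  rw [← excess_transpose_gram _ hq] at h ⊢
  exact oneWayAchieves_distillation (by rw [frobSq_transpose, hΦ]) hM hq h

lemma exists_distillation_one (c : CommClass) {φ : EuclideanSpace ℂ (A × B)} (hφ : ‖φ‖ = 1) :
    ∃ T, IsLOCC c T ∧ 1 ≤ fidelity (maxEntangled 1) (T (ketBra φ)) := by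
  have hΦ : frobSq (coeffMatrix φ) = 1 := by rw [frobSq_coeffMatrix, hφ, one_pow]
  refine exists_isLOCC c (oneWayAchieves_product hΦ) ?_
  rw [transpose_coeffMatrix_maxEntangled]
  exact oneWayAchieves_product (by rw [frobSq_transpose, hΦ])

end Distillation

/-! ### Dilution -/

section Dilution

variable {A B : Type} [Fintype A] [DecidableEq A] [Fintype B] [DecidableEq B]

/-- There are at most 1/q eigenvalues ≥ q, and p is their total weight. Alice's Kraus operators
write the corresponding Schmidt coefficients, divided by √p, onto Ψ_M up to a cyclic shift, and Bob
undoes the shift. Every branch yields the same truncated vector, so the fidelity is p ≥ excess. -/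
lemma oneWayAchieves_dilution {Φ : Matrix A B ℂ} (hΦ : frobSq Φ = 1) {q : ℝ} (hq : 0 < q)
    (h : 0 < excess (Φ * Φᴴ) q) :
    ∃ M : ℕ, 1 ≤ M ∧ M * q ≤ 1 ∧
      OneWayAchieves (coeffMatrix (maxEntangled M)) Φ (excess (Φ * Φᴴ) q) := by
  have hs := isState_gram hΦ
  have hH := hs.1.1
  set U : Matrix A A ℂ := (hH.eigenvectorUnitary : Matrix A A ℂ) with hU
  have hUU : Uᴴ * U = 1 := conjTranspose_mul_eigenvectorUnitary hH
  set lam := hH.eigenvalues with hlam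
  set S := {i // q ≤ lam i} with hS
  set M := Fintype.card S with hMd
  let e : Fin M ≃ S := (Fintype.equivFin S).symm
  set p : ℝ := ∑ x : Fin M, lam (e x) with hp
  have hpS : p = ∑ i with q ≤ lam i, lam i := by
    rw [hp, e.sum_comp fun i : S => lam i]
    exact (Finset.sum_subtype _ (by simp) _).symm
  have hle : excess (Φ * Φᴴ) q ≤ p := by
    rw [excess_eq_sum hH, hpS, Finset.sum_filter]
    refine Finset.sum_le_sum fun i _ => ?_
    split_ifs with hi
    · exact max_le (by linarith) (hq.le.trans hi)
    · exact max_le (by linarith) le_rfl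
  have hp0 : 0 < p := h.trans_le hle
  have hMq : M * q ≤ 1 := by
    calc (M : ℝ) * q = ∑ _x : Fin M, q := by simp
      _ ≤ p := Finset.sum_le_sum fun x _ => (e x).2
      _ ≤ ∑ i, lam i := by
        rw [hpS]
        exact Finset.sum_le_sum_of_subset_of_nonneg (Finset.filter_subset _ _)
          fun i _ _ => hs.1.eigenvalues_nonneg i
      _ = 1 := hs.sum_eigenvalues
  have hM : 1 ≤ M := by
    by_contra hM
    have : M = 0 := by omega
    have : IsEmpty (Fin M) := by rw [this]; infer_instance
    rw [hp, Finset.univ_eq_empty, Finset.sum_empty] at hp0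
    exact lt_irrefl _ hp0
  have : NeZero M := ⟨by omega⟩
  have hM0 : (0 : ℝ) < M := by exact_mod_cast hM
  have hlp : ∀ x : Fin M, 0 < lam (e x) := fun x => hq.trans_le (e x).2
  refine ⟨M, hM, hMq, ?_⟩
  set V : Matrix A (Fin M) ℂ := U.submatrix id fun x => (e x : A) with hV
  have hVV : Vᴴ * V = 1 := by
    have : Vᴴ * V = (Uᴴ * U).submatrix (fun x => (e x : A)) fun x => (e x : A) := by
      rw [hV, conjTranspose_submatrix, submatrix_mul _ _ _ id _ Function.bijective_id]
    rw [this, hUU]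
    exact submatrix_one _ (Subtype.val_injective.comp e.injective)
  set R : Matrix (Fin M) B ℂ := Vᴴ * Φ with hR
  have hRR : R * Rᴴ = diagonal fun x => (lam (e x) : ℂ) := by
    have h1 : Φ * Φᴴ * V = V * diagonal fun x => (lam (e x) : ℂ) := by
      have h2 : Φ * Φᴴ * U = U * diagonal fun i => (lam i : ℂ) := by
        conv_lhs => rw [spectral_decomposition hH]
        rw [Matrix.mul_assoc, hUU, Matrix.mul_one]
      ext a x
      have := congrFun (congrFun h2 a) (e x)
      rw [mul_diagonal] at this ⊢
      exact this
    rw [hR, conjTranspose_mul, conjTranspose_conjTranspose, Matrix.mul_assoc,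
      ← Matrix.mul_assoc Φ, h1, ← Matrix.mul_assoc, hVV, Matrix.one_mul]
  set D : Matrix (Fin M) (Fin M) ℂ := diagonal fun x => ((1 / Real.sqrt (lam (e x)) : ℝ) : ℂ)
    with hD
  have hDh : Dᴴ = D := by
    rw [hD, diagonal_conjTranspose]; congr 1; funext b; simp
  set E : Matrix (Fin M) (Fin M) ℂ :=
    diagonal fun x => ((Real.sqrt (lam (e x)) / Real.sqrt p : ℝ) : ℂ) with hE
  have hEh : Eᴴ = E := by
    rw [hE, diagonal_conjTranspose]; congr 1; funext b; simp
  set Z : Matrix (Fin M) B ℂ := D * R with hZ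
  -- The rows of Z are the normalised Schmidt vectors on Bob's side, so `Zᵀ` is an isometry.
  have hZZ : Z * Zᴴ = 1 := by
    rw [hZ, conjTranspose_mul, hDh]
    calc D * R * (Rᴴ * D) = D * (R * Rᴴ) * D := by simp only [Matrix.mul_assoc]
      _ = 1 := by
        rw [hRR, hD, diagonal_mul_diagonal, diagonal_mul_diagonal, ← diagonal_one]
        congr 1; funext x
        rw [← Complex.ofReal_mul, ← Complex.ofReal_mul]
        have h1 := Real.sqrt_pos.2 (hlp x)
        have h2 := Real.mul_self_sqrt (hlp x).le
        have : 1 / √(lam (e x)) * lam (e x) * (1 / √(lam (e x))) = 1 := by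
          field_simp; rw [sq]; exact h2.symm
        rw [this, Complex.ofReal_one]
  have hEE : Eᴴ * E = diagonal fun x => ((lam (e x) / p : ℝ) : ℂ) := by
    rw [hEh, hE, diagonal_mul_diagonal]
    congr 1; funext x
    rw [← Complex.ofReal_mul, div_mul_div_comm, Real.mul_self_sqrt (hlp x).le,
      Real.mul_self_sqrt hp0.le]
  -- Summed over all shifts, each diagonal entry runs once through all λ/p, which gives
  -- completeness.
  let σ : Fin M → Fin M ≃ Fin M := fun x => Equiv.addRight x
  refine ⟨Fin M, Unit, inferInstance, inferInstance, fun x => (V * E).submatrix id (σ x),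
    fun x _ => Zᵀ.submatrix id (σ x), ?_, fun x => ?_, ?_⟩
  · have h1 : ∀ x, ((V * E).submatrix id (σ x))ᴴ * (V * E).submatrix id (σ x) =
        diagonal fun i => ((lam (e (i + x)) / p : ℝ) : ℂ) := by
      intro x
      rw [conjTranspose_submatrix, ← submatrix_mul _ _ _ id _ Function.bijective_id,
        conjTranspose_mul, Matrix.mul_assoc, ← Matrix.mul_assoc Vᴴ, hVV, Matrix.one_mul, hEE,
        submatrix_diagonal_equiv]
      rfl
    simp only [h1]
    ext i j
    rw [Matrix.sum_apply]
    by_cases hij : i = j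
    · subst hij
      simp only [diagonal_apply_eq, one_apply_eq]
      have h2 := Equiv.sum_comp (Equiv.addLeft i) fun x => lam (e x)
      simp only [Equiv.coe_addLeft] at h2
      rw [← Complex.ofReal_sum, ← Finset.sum_div, h2, ← hp, div_self hp0.ne',
        Complex.ofReal_one]
    · simp [hij]
  · have h1 : Zᵀᴴ * Zᵀ = 1 := by
      have : Zᵀᴴ * Zᵀ = (Z * Zᴴ)ᵀ := (transpose_mul Z Zᴴ).symm
      rw [this, hZZ, transpose_one]
    rw [Fintype.sum_unique, conjTranspose_submatrix,
      ← submatrix_mul _ _ _ id _ Function.bijective_id, h1, submatrix_one_equiv]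
  · refine hle.trans ?_
    have h1 : ∀ x, (V * E).submatrix id (σ x) * coeffMatrix (maxEntangled M) *
        (Zᵀ.submatrix id (σ x))ᵀ = ((1 / Real.sqrt M : ℝ) : ℂ) • (V * E * Z) := by
      intro x
      rw [coeffMatrix_maxEntangled, Matrix.mul_smul, Matrix.mul_one, Matrix.smul_mul,
        transpose_submatrix, transpose_transpose, submatrix_mul_equiv, submatrix_id_id]
    have h2 : (Φᴴ * (V * E * Z)).trace = ((Real.sqrt p : ℝ) : ℂ) := by
      have hED : E * D = diagonal fun _ => ((1 / Real.sqrt p : ℝ) : ℂ) := by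
        rw [hE, hD, diagonal_mul_diagonal]
        congr 1; funext x
        rw [← Complex.ofReal_mul]
        have h1 := Real.sqrt_pos.2 (hlp x)
        congr 1; field_simp
      calc (Φᴴ * (V * E * Z)).trace = (Rᴴ * (E * D * R)).trace := by
            rw [hZ, hR, conjTranspose_mul, conjTranspose_conjTranspose]
            simp only [Matrix.mul_assoc]
        _ = (E * D * (R * Rᴴ)).trace := by
            rw [trace_mul_comm]; simp only [Matrix.mul_assoc]
        _ = _ := by
            rw [hED, hRR, diagonal_mul_diagonal, trace_diagonal, ← Finset.mul_sum,
              ← Complex.ofReal_sum, ← hp, ← Complex.ofReal_mul, one_div_mul_eq_div,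
              Real.div_sqrt]
    simp only [h1, Fintype.sum_unique, Matrix.mul_smul, trace_smul, h2]
    rw [Finset.sum_const, Finset.card_univ, Fintype.card_fin, nsmul_eq_mul, smul_eq_mul,
      ← Complex.ofReal_mul, Complex.norm_real, Real.norm_eq_abs, sq_abs, mul_pow, div_pow,
      Real.sq_sqrt hM0.le, Real.sq_sqrt hp0.le, one_pow, ← mul_assoc, mul_one_div_cancel hM0.ne',
      one_mul]

/-- One-shot dilution. -/
lemma exists_dilution (c : CommClass) {φ : EuclideanSpace ℂ (A × B)} (hφ : ‖φ‖ = 1) {q : ℝ}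
    (hq : 0 < q) (h : 0 < excess (reducedA (ketBra φ)) q) :
    ∃ M : ℕ, 1 ≤ M ∧ M * q ≤ 1 ∧ ∃ T, IsLOCC c T ∧
      excess (reducedA (ketBra φ)) q ≤ fidelity φ (T (ketBra (maxEntangled M))) := by
  have hΦ : frobSq (coeffMatrix φ) = 1 := by rw [frobSq_coeffMatrix, hφ, one_pow]
  rw [reducedA_ketBra] at h ⊢
  obtain ⟨M, hM, hMq, h1⟩ := oneWayAchieves_dilution hΦ hq h
  cases c
  · exact ⟨M, hM, hMq, h1.forward⟩
  -- With B speaking first, the construction is repeated for the transposed matrix, which supplies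
  -- its own M.
  · rw [← excess_transpose_gram _ hq.le] at h ⊢
    obtain ⟨M, hM, hMq, h1⟩ := oneWayAchieves_dilution (by rw [frobSq_transpose, hΦ]) hq h
    rw [← transpose_coeffMatrix_maxEntangled] at h1
    exact ⟨M, hM, hMq, h1.backward⟩
  · obtain ⟨T, hT, hF⟩ := h1.forward
    exact ⟨M, hM, hMq, T, hT.isTwoWayLOCC, hF⟩

end Dilution

/-! ### Spectral entropy rates as limits -/

/-- The bounds give the boundedness needed for a real-valued limsup and squeeze the liminf. They are
asked only from n = 1 because index 0 is unconstrained. -/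
lemma limsup_eq_zero_iff {u : ℕ → ℝ} (h0 : ∀ n, 1 ≤ n → 0 ≤ u n) (h1 : ∀ n, 1 ≤ n → u n ≤ 1) :
    limsup u atTop = 0 ↔ Tendsto u atTop (𝓝 0) := by
  have h0' : ∀ᶠ n in atTop, 0 ≤ u n := eventually_atTop.2 ⟨1, h0⟩
  have h1' : ∀ᶠ n in atTop, u n ≤ 1 := eventually_atTop.2 ⟨1, h1⟩
  have hb : IsBoundedUnder (· ≤ ·) atTop u := isBoundedUnder_of_eventually_le h1'
  have hb' : IsBoundedUnder (· ≥ ·) atTop u := isBoundedUnder_of_eventually_ge h0'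
  refine ⟨fun h => ?_, fun h => h.limsup_eq⟩
  exact tendsto_of_le_liminf_of_limsup_le (le_liminf_of_le hb.isCoboundedUnder_ge h0') h.le hb hb'

lemma liminf_eq_one_iff {u : ℕ → ℝ} (h0 : ∀ n, 1 ≤ n → 0 ≤ u n) (h1 : ∀ n, 1 ≤ n → u n ≤ 1) :
    liminf u atTop = 1 ↔ Tendsto u atTop (𝓝 1) := by
  have h0' : ∀ᶠ n in atTop, 0 ≤ u n := eventually_atTop.2 ⟨1, h0⟩
  have h1' : ∀ᶠ n in atTop, u n ≤ 1 := eventually_atTop.2 ⟨1, h1⟩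
  have hb : IsBoundedUnder (· ≤ ·) atTop u := isBoundedUnder_of_eventually_le h1'
  have hb' : IsBoundedUnder (· ≥ ·) atTop u := isBoundedUnder_of_eventually_ge h0'
  refine ⟨fun h => ?_, fun h => h.liminf_eq⟩
  exact tendsto_of_le_liminf_of_limsup_le h.ge (limsup_le_of_le hb'.isCoboundedUnder_le h1') hb hb'

lemma tendsto_zero_of_forall_eventually_le {u : ℕ → ℝ} (h0 : ∀ᶠ n in atTop, 0 ≤ u n)
    (h : ∀ δ > 0, ∀ᶠ n in atTop, u n ≤ δ) : Tendsto u atTop (𝓝 0) := by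
  refine tendsto_order.2 ⟨fun a ha => ?_, fun a ha => ?_⟩
  · filter_upwards [h0] with n hn using ha.trans_le hn
  · filter_upwards [h (a / 2) (half_pos ha)] with n hn
    linarith

lemma tendsto_exp_nat_mul_neg {a : ℝ} (ha : a < 0) :
    Tendsto (fun n : ℕ => Real.exp (n * a)) atTop (𝓝 0) :=
  Real.tendsto_exp_atBot.comp (tendsto_natCast_atTop_atTop.atTop_mul_const_of_neg ha)

section EntropyRates

variable {ι : ℕ → Type} [∀ n, Fintype (ι n)] [∀ n, DecidableEq (ι n)]

lemma infEntropyRate_eq {ρ : ∀ n, Matrix (ι n) (ι n) ℂ} (hρ : ∀ n, 1 ≤ n → IsState (ρ n)) :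
    infEntropyRate ρ = -sInf ((fun γ : ℝ => (γ : EReal)) ''
      {γ | Tendsto (fun n : ℕ => excess (ρ n) (Real.exp (n * γ))) atTop (𝓝 0)}) := by
  rw [infEntropyRate, supDivergenceRate]
  congr 3
  ext γ
  exact limsup_eq_zero_iff (fun n hn => (hρ n hn).excess_nonneg _)
    (fun n hn => (hρ n hn).excess_le_one (Real.exp_pos _).le)

lemma supEntropyRate_eq {ρ : ∀ n, Matrix (ι n) (ι n) ℂ} (hρ : ∀ n, 1 ≤ n → IsState (ρ n)) :
    supEntropyRate ρ = -sSup ((fun γ : ℝ => (γ : EReal)) ''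
      {γ | Tendsto (fun n : ℕ => excess (ρ n) (Real.exp (n * γ))) atTop (𝓝 1)}) := by
  rw [supEntropyRate, infDivergenceRate]
  congr 3
  ext γ
  exact liminf_eq_one_iff (fun n hn => (hρ n hn).excess_nonneg _)
    (fun n hn => (hρ n hn).excess_le_one (Real.exp_pos _).le)

/-- The admissible set of γ is upward closed, since the excess decreases in q. -/
lemma tendsto_excess_zero_of_infEntropyRate {ρ : ∀ n, Matrix (ι n) (ι n) ℂ}
    (hρ : ∀ n, 1 ≤ n → IsState (ρ n)) {γ : ℝ} (h : ((-γ : ℝ) : EReal) < infEntropyRate ρ) :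
    Tendsto (fun n : ℕ => excess (ρ n) (Real.exp (n * γ))) atTop (𝓝 0) := by
  rw [infEntropyRate_eq hρ, EReal.coe_neg, EReal.neg_lt_neg_iff, sInf_lt_iff] at h
  obtain ⟨_, ⟨γ', hγ', rfl⟩, h⟩ := h
  have h' : γ' ≤ γ := EReal.coe_le_coe_iff.1 h.le
  refine squeeze_zero' (eventually_atTop.2 ⟨1, fun n hn => (hρ n hn).excess_nonneg _⟩)
    (eventually_atTop.2 ⟨1, fun n hn => (hρ n hn).excess_anti ?_⟩) hγ'
  gcongr

lemma tendsto_excess_one_of_supEntropyRate {ρ : ∀ n, Matrix (ι n) (ι n) ℂ}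
    (hρ : ∀ n, 1 ≤ n → IsState (ρ n)) {γ : ℝ} (h : supEntropyRate ρ < ((-γ : ℝ) : EReal)) :
    Tendsto (fun n : ℕ => excess (ρ n) (Real.exp (n * γ))) atTop (𝓝 1) := by
  rw [supEntropyRate_eq hρ, EReal.coe_neg, EReal.neg_lt_neg_iff, lt_sSup_iff] at h
  obtain ⟨_, ⟨γ', hγ', rfl⟩, h⟩ := h
  have h' : γ ≤ γ' := EReal.coe_le_coe_iff.1 h.le
  refine tendsto_of_tendsto_of_tendsto_of_le_of_le' hγ' tendsto_const_nhds
    (eventually_atTop.2 ⟨1, fun n hn => (hρ n hn).excess_anti ?_⟩)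
    (eventually_atTop.2 ⟨1, fun n hn => (hρ n hn).excess_le_one (Real.exp_pos _).le⟩)
  gcongr

lemma infEntropyRate_eq_coe {ρ : ∀ n, Matrix (ι n) (ι n) ℂ} (hρ : ∀ n, 1 ≤ n → IsState (ρ n))
    {S : ℝ}
    (h1 : ∀ γ, -S < γ → Tendsto (fun n : ℕ => excess (ρ n) (Real.exp (n * γ))) atTop (𝓝 0))
    (h2 : ∀ γ, γ < -S → ¬ Tendsto (fun n : ℕ => excess (ρ n) (Real.exp (n * γ))) atTop (𝓝 0)) :
    infEntropyRate ρ = S := by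
  rw [infEntropyRate_eq hρ, neg_eq_iff_eq_neg, ← EReal.coe_neg]
  refine le_antisymm ?_ (le_sInf ?_)
  · refine EReal.le_of_forall_lt_iff_le.1 fun z hz => sInf_le ⟨z, h1 z (by exact_mod_cast hz), rfl⟩
  · rintro _ ⟨γ, hγ, rfl⟩
    refine EReal.coe_le_coe_iff.2 (le_of_not_gt fun h => h2 γ h hγ)

lemma supEntropyRate_eq_coe {ρ : ∀ n, Matrix (ι n) (ι n) ℂ} (hρ : ∀ n, 1 ≤ n → IsState (ρ n))
    {S : ℝ}
    (h1 : ∀ γ, γ < -S → Tendsto (fun n : ℕ => excess (ρ n) (Real.exp (n * γ))) atTop (𝓝 1))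
    (h2 : ∀ γ, -S < γ → ¬ Tendsto (fun n : ℕ => excess (ρ n) (Real.exp (n * γ))) atTop (𝓝 1)) :
    supEntropyRate ρ = S := by
  rw [supEntropyRate_eq hρ, neg_eq_iff_eq_neg, ← EReal.coe_neg]
  refine le_antisymm (sSup_le ?_) ?_
  · rintro _ ⟨γ, hγ, rfl⟩
    refine EReal.coe_le_coe_iff.2 (le_of_not_gt fun h => h2 γ h hγ)
  · refine EReal.ge_of_forall_gt_iff_ge.1 fun z hz => le_sSup ⟨z, h1 z (by exact_mod_cast hz), rfl⟩

end EntropyRates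

/-! ### Rates of distillation and dilution -/

section RatesEq

variable {A B : ℕ → Type} [∀ n, Fintype (A n)] [∀ n, DecidableEq (A n)]
  [∀ n, Fintype (B n)] [∀ n, DecidableEq (B n)]
  {φ : ∀ n, EuclideanSpace ℂ (A n × B n)}

lemma isState_reducedSeqA (hφ : ∀ n, 1 ≤ n → ‖φ n‖ = 1) (n : ℕ) (hn : 1 ≤ n) :
    IsState (reducedSeqA φ n) :=
  isState_gram (Φ := coeffMatrix (φ n)) (by rw [frobSq_coeffMatrix, hφ n hn, one_pow])

lemma isState_reducedSeqB (hφ : ∀ n, 1 ≤ n → ‖φ n‖ = 1) (n : ℕ) (hn : 1 ≤ n) :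
    IsState (reducedSeqB φ n) :=
  isState_gram (Φ := (coeffMatrix (φ n))ᵀ)
    (by rw [frobSq_transpose, frobSq_coeffMatrix, hφ n hn, one_pow])

lemma infEntropyRate_reducedSeqB (hφ : ∀ n, 1 ≤ n → ‖φ n‖ = 1) :
    infEntropyRate (reducedSeqB φ) = infEntropyRate (reducedSeqA φ) := by
  rw [infEntropyRate_eq (isState_reducedSeqA hφ), infEntropyRate_eq (isState_reducedSeqB hφ)]
  simp only [reducedSeqA, reducedSeqB, excess_reducedB_eq _ (Real.exp_pos _).le]

lemma supEntropyRate_reducedSeqB (hφ : ∀ n, 1 ≤ n → ‖φ n‖ = 1) :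
    supEntropyRate (reducedSeqB φ) = supEntropyRate (reducedSeqA φ) := by
  rw [supEntropyRate_eq (isState_reducedSeqA hφ), supEntropyRate_eq (isState_reducedSeqB hφ)]
  simp only [reducedSeqA, reducedSeqB, excess_reducedB_eq _ (Real.exp_pos _).le]

lemma exp_mul_le_of_le_log {n M : ℕ} (hn : 1 ≤ n) (hM : 1 ≤ M) {R : ℝ}
    (h : R ≤ 1 / (n : ℝ) * Real.log M) : Real.exp (n * R) ≤ M := by
  have hn0 : (0 : ℝ) < n := by exact_mod_cast hn
  rw [one_div_mul_eq_div, le_div_iff₀ hn0, mul_comm] at h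
  exact (Real.le_log_iff_exp_le (by exact_mod_cast hM)).1 h

lemma le_exp_mul_of_log_le {n M : ℕ} (hn : 1 ≤ n) (hM : 1 ≤ M) {R : ℝ}
    (h : 1 / (n : ℝ) * Real.log M ≤ R) : (M : ℝ) ≤ Real.exp (n * R) := by
  have hn0 : (0 : ℝ) < n := by exact_mod_cast hn
  rw [one_div_mul_eq_div, div_le_iff₀ hn0, mul_comm] at h
  exact (Real.log_le_iff_le_exp (by exact_mod_cast hM)).1 h

lemma IsDistillationRate.tendsto_excess (hφ : ∀ n, 1 ≤ n → ‖φ n‖ = 1) {c : CommClass} {R γ : ℝ}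
    (hR : IsDistillationRate c (fun n => ketBra (φ n)) R) (hγ : -R < γ) :
    Tendsto (fun n : ℕ => excess (reducedSeqA φ n) (Real.exp (n * γ))) atTop (𝓝 0) := by
  refine tendsto_zero_of_forall_eventually_le
    (eventually_atTop.2 ⟨1, fun n hn => (isState_reducedSeqA hφ n hn).excess_nonneg _⟩)
    fun δ hδ => ?_
  obtain ⟨N, hN⟩ := hR (δ / 2) (half_pos hδ)
  -- This sequence is the parameter `a` of `distillation_excess_le`: its square cancels e^{n(R+γ)} ≤
  -- Mq exactly, and it still tends to 0.
  have ha : Tendsto (fun n : ℕ => Real.exp (n * (-(γ + R) / 2))) atTop (𝓝 0) :=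
    tendsto_exp_nat_mul_neg (by linarith)
  have hb := (ha.pow 2).add (ha.const_mul 2)
  simp only [ne_eq, OfNat.ofNat_ne_zero, not_false_eq_true, zero_pow, mul_zero, add_zero] at hb
  filter_upwards [hb.eventually (ge_mem_nhds (half_pos hδ)), eventually_ge_atTop N,
    eventually_ge_atTop 1] with n hn hnN hn1
  obtain ⟨M, hM, T, hT, hF, hRM⟩ := hN n hnN
  have hM' := exp_mul_le_of_le_log hn1 hM hRM
  have key := distillation_excess_le (hφ n hn1) hM hT.isSeparable (Real.exp_pos (n * γ))
    (Real.exp_pos (n * (-(γ + R) / 2))).le (by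
      calc (1 : ℝ) = Real.exp (n * (-(γ + R) / 2)) ^ 2 * (Real.exp (n * R) * Real.exp (n * γ)) := by
            rw [← Real.exp_nat_mul, ← Real.exp_add, ← Real.exp_add, ← Real.exp_zero]
            congr 1; push_cast; ring
        _ ≤ _ := by gcongr)
  show excess (reducedA (ketBra (φ n))) _ ≤ δ
  linarith

lemma isDistillationRate_of_tendsto (hφ : ∀ n, 1 ≤ n → ‖φ n‖ = 1) (c : CommClass) {R γ : ℝ}
    (hγ : Tendsto (fun n : ℕ => excess (reducedSeqA φ n) (Real.exp (n * γ))) atTop (𝓝 0))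
    (hR : R < -γ) : IsDistillationRate c (fun n => ketBra (φ n)) R := by
  intro ε hε
  -- For R ≤ 0 the choice M = 1 suffices. For R > 0 one has e^{nR} ≥ 1, so rounding up at most
  -- doubles it.
  rcases le_or_gt R 0 with hR0 | hR0
  · refine ⟨1, fun n hn => ⟨1, le_rfl, ?_⟩⟩
    obtain ⟨T, hT, hF⟩ := exists_distillation_one c (hφ n hn)
    exact ⟨T, hT, by linarith, by simpa using hR0⟩
  · have hq : Tendsto (fun n : ℕ => 2 * Real.exp (n * (R + γ))) atTop (𝓝 0) := by
      simpa using (tendsto_exp_nat_mul_neg (show R + γ < 0 by linarith)).const_mul 2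
    have hs := hγ.add hq
    rw [add_zero] at hs
    obtain ⟨N, hN⟩ := eventually_atTop.1
      ((hs.eventually (gt_mem_nhds (lt_min hε one_pos))).and (eventually_ge_atTop 1))
    refine ⟨N, fun n hn => ?_⟩
    obtain ⟨h1, hn1⟩ := hN n hn
    have hn0 : (0 : ℝ) < n := by exact_mod_cast hn1
    set M := ⌈Real.exp (n * R)⌉₊ with hM
    have hM1 : 1 ≤ M := Nat.one_le_ceil_iff.2 (Real.exp_pos _)
    have hMle : (M : ℝ) * Real.exp (n * γ) ≤ 2 * Real.exp (n * (R + γ)) := by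
      have h2 : (M : ℝ) ≤ 2 * Real.exp (n * R) := by
        have h3 := (Nat.ceil_lt_add_one (Real.exp_pos (n * R)).le).le
        have h4 : 1 ≤ Real.exp (n * R) := Real.one_le_exp (by positivity)
        linarith
      calc (M : ℝ) * Real.exp (n * γ) ≤ 2 * Real.exp (n * R) * Real.exp (n * γ) := by gcongr
        _ = _ := by rw [mul_assoc, ← Real.exp_add, ← mul_add]
    have h5 : excess (reducedA (ketBra (φ n))) (Real.exp (n * γ)) +
        2 * Real.exp (n * (R + γ)) < min ε 1 := h1
    obtain ⟨T, hT, hF⟩ := exists_distillation c (hφ n hn1) hM1 (Real.exp_pos (n * γ)).le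
      (by linarith [min_le_right ε 1])
    refine ⟨M, hM1, T, hT, by linarith [min_le_left ε 1], ?_⟩
    rw [one_div_mul_eq_div, le_div_iff₀ hn0, mul_comm,
      Real.le_log_iff_exp_le (by exact_mod_cast hM1)]
    exact Nat.le_ceil _

/-- Achievable R and vanishing thresholds γ correspond under R = -γ up to arbitrarily small slack,
which the supremum and infimum do not see, even at infinite values. -/
theorem distillableEntanglement_eq (hφ : ∀ n, 1 ≤ n → ‖φ n‖ = 1) (c : CommClass) :
    distillableEntanglement c φ = infEntropyRate (reducedSeqA φ) := by
  rw [infEntropyRate_eq (isState_reducedSeqA hφ), distillableEntanglement]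
  refine le_antisymm (sSup_le ?_) ?_
  · rintro _ ⟨R, hR, rfl⟩
    refine EReal.le_neg_of_le_neg ?_
    rw [← EReal.coe_neg]
    exact EReal.le_of_forall_lt_iff_le.1 fun z hz =>
      sInf_le ⟨z, IsDistillationRate.tendsto_excess hφ hR (by exact_mod_cast hz), rfl⟩
  · refine EReal.neg_le_of_neg_le (le_sInf ?_)
    rintro _ ⟨γ, hγ, rfl⟩
    refine EReal.neg_le_of_neg_le ?_
    rw [← EReal.coe_neg]
    exact EReal.ge_of_forall_gt_iff_ge.1 fun z hz =>
      le_sSup ⟨z, isDistillationRate_of_tendsto hφ c hγ (by exact_mod_cast hz), rfl⟩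

lemma IsDilutionRate.tendsto_excess (hφ : ∀ n, 1 ≤ n → ‖φ n‖ = 1) {c : CommClass} {R γ : ℝ}
    (hR : IsDilutionRate c φ R) (hγ : γ < -R) :
    Tendsto (fun n : ℕ => excess (reducedSeqA φ n) (Real.exp (n * γ))) atTop (𝓝 1) := by
  have h0 : Tendsto (fun n : ℕ => 1 - excess (reducedSeqA φ n) (Real.exp (n * γ))) atTop
      (𝓝 0) := by
    refine tendsto_zero_of_forall_eventually_le (eventually_atTop.2 ⟨1, fun n hn => sub_nonneg.2 <|
      (isState_reducedSeqA hφ n hn).excess_le_one (Real.exp_pos _).le⟩) fun δ hδ => ?_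
    obtain ⟨N, hN⟩ := hR (δ / 2) (half_pos hδ)
    have ha := tendsto_exp_nat_mul_neg (show R + γ < 0 by linarith)
    filter_upwards [ha.eventually (ge_mem_nhds (half_pos hδ)), eventually_ge_atTop N,
      eventually_ge_atTop 1] with n hn hnN hn1
    obtain ⟨M, hM, T, hT, hF, hRM⟩ := hN n hnN
    have hM' := le_exp_mul_of_log_le hn1 hM hRM
    have key := dilution_fidelity_le (φ := φ n) hM hT.isSeparable (Real.exp_pos (n * γ)).le
    have h2 : (M : ℝ) * Real.exp (n * γ) ≤ Real.exp (n * (R + γ)) := by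
      rw [mul_add, Real.exp_add]; gcongr
    show 1 - excess (reducedA (ketBra (φ n))) _ ≤ δ
    linarith
  simpa using h0.const_sub 1

lemma isDilutionRate_of_tendsto (hφ : ∀ n, 1 ≤ n → ‖φ n‖ = 1) (c : CommClass) {γ : ℝ}
    (hγ : Tendsto (fun n : ℕ => excess (reducedSeqA φ n) (Real.exp (n * γ))) atTop (𝓝 1)) :
    IsDilutionRate c φ (-γ) := by
  intro ε hε
  obtain ⟨N, hN⟩ := eventually_atTop.1
    -- The maximum with 0 guarantees a positive excess, as one-shot dilution requires, even when ε ≥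
    -- 1.
    ((hγ.eventually (lt_mem_nhds (max_lt (sub_lt_self 1 hε) one_pos))).and (eventually_ge_atTop 1))
  refine ⟨N, fun n hn => ?_⟩
  obtain ⟨h1, hn1⟩ := hN n hn
  have hn0 : (0 : ℝ) < n := by exact_mod_cast hn1
  obtain ⟨M, hM, hMq, T, hT, hF⟩ := exists_dilution c (hφ n hn1) (Real.exp_pos (n * γ))
    ((le_max_right _ _).trans_lt h1)
  refine ⟨M, hM, T, hT, ((le_max_left _ _).trans h1.le).trans hF, ?_⟩
  rw [one_div_mul_eq_div, div_le_iff₀ hn0, Real.log_le_iff_le_exp (by exact_mod_cast hM),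
    neg_mul, Real.exp_neg, mul_comm γ, ← one_div, le_div_iff₀ (Real.exp_pos _)]
  exact hMq

theorem entanglementCost_eq (hφ : ∀ n, 1 ≤ n → ‖φ n‖ = 1) (c : CommClass) :
    entanglementCost c φ = supEntropyRate (reducedSeqA φ) := by
  rw [supEntropyRate_eq (isState_reducedSeqA hφ), entanglementCost]
  refine le_antisymm (EReal.le_neg_of_le_neg (sSup_le ?_)) (le_sInf ?_)
  · rintro _ ⟨γ, hγ, rfl⟩
    refine EReal.le_neg_of_le_neg ?_
    rw [← EReal.coe_neg]
    exact sInf_le ⟨-γ, isDilutionRate_of_tendsto hφ c hγ, rfl⟩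
  · rintro _ ⟨R, hR, rfl⟩
    refine EReal.neg_le_of_neg_le ?_
    rw [← EReal.coe_neg]
    exact EReal.ge_of_forall_gt_iff_ge.1 fun z hz =>
      le_sSup ⟨z, IsDilutionRate.tendsto_excess hφ hR (by exact_mod_cast hz), rfl⟩

end RatesEq

/-! ### The von Neumann entropy rate -/

section Entropy

variable {m : Type} [Fintype m] [DecidableEq m]

lemma IsState.eigenvalues_le_one {ρ : Matrix m m ℂ} (h : IsState ρ) (i : m) :
    h.1.1.eigenvalues i ≤ 1 := by
  rw [← h.sum_eigenvalues]
  exact Finset.single_le_sum (f := fun i => h.1.1.eigenvalues i)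
    (fun i _ => h.1.eigenvalues_nonneg i) (Finset.mem_univ i)

lemma IsState.vonNeumannEntropy_nonneg {ρ : Matrix m m ℂ} (h : IsState ρ) :
    0 ≤ vonNeumannEntropy ρ := by
  rw [vonNeumannEntropy_eq h.1.1]
  exact Finset.sum_nonneg fun i _ =>
    Real.negMulLog_nonneg (h.1.eigenvalues_nonneg i) (h.eigenvalues_le_one i)

/-- For x ≤ q, -log x ≥ -log q. For x > q, the cutoff q/2 and the factor 2 make the bracket at most
q - x < 0, so the bound is trivial. -/
lemma negMulLog_ge {x q : ℝ} (hx0 : 0 ≤ x) (hx1 : x ≤ 1) (hq0 : 0 < q) (hq1 : q ≤ 1) :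
    -Real.log q * (x - 2 * max (x - q / 2) 0) ≤ Real.negMulLog x := by
  have hlq : 0 ≤ -Real.log q := neg_nonneg.2 (Real.log_nonpos hq0.le hq1)
  rcases le_or_gt x q with h | h
  · rcases hx0.eq_or_lt with rfl | hx0
    · have : max (0 - q / 2) 0 = 0 := max_eq_right (by linarith)
      rw [this]; simp
    · have h1 := Real.log_le_log hx0 h
      have h2 : x - 2 * max (x - q / 2) 0 ≤ x := by linarith [le_max_right (x - q / 2) 0]
      calc -Real.log q * (x - 2 * max (x - q / 2) 0) ≤ -Real.log q * x := by gcongr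
        _ ≤ -Real.log x * x := by gcongr
        _ = Real.negMulLog x := by rw [Real.negMulLog]; ring
  · refine le_trans ?_ (Real.negMulLog_nonneg hx0 hx1)
    refine mul_nonpos_of_nonneg_of_nonpos hlq ?_
    linarith [le_max_left (x - q / 2) 0]

/-- This is log y ≤ y - 1 at y = e^{-c}/x, with a term -x dropped. -/
lemma negMulLog_le_tangent {x : ℝ} (hx : 0 < x) (c : ℝ) :
    Real.negMulLog x ≤ c * x + Real.exp (-c) := by
  have h := Real.log_le_sub_one_of_pos (div_pos (Real.exp_pos (-c)) hx)
  rw [Real.log_div (Real.exp_pos _).ne' hx.ne', Real.log_exp] at h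
  have h2 := mul_le_mul_of_nonneg_left h hx.le
  rw [mul_sub, mul_sub, mul_div_cancel₀ _ hx.ne'] at h2
  rw [Real.negMulLog]
  nlinarith

/-- Above q, -log x ≤ -log q suffices; below q, the linear bound of slope c applies. The constant is
charged only to nonzero x, so that summation costs the rank rather than the dimension. -/
lemma negMulLog_le {x q c : ℝ} (hx0 : 0 ≤ x) (hq0 : 0 < q) (hq1 : q ≤ 1) (hc : 0 ≤ c) :
    Real.negMulLog x ≤ -Real.log q * x + c * min x q + if x = 0 then 0 else Real.exp (-c) := by
  have hlq : 0 ≤ -Real.log q := neg_nonneg.2 (Real.log_nonpos hq0.le hq1)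
  rcases hx0.eq_or_lt with rfl | hx0
  · simp [hq0.le]
  rw [if_neg hx0.ne']
  rcases le_total x q with h | h
  · rw [min_eq_left h]
    have := mul_nonneg hlq hx0.le
    linarith [negMulLog_le_tangent hx0 c]
  · have h1 := Real.log_le_log hq0 h
    have h2 : Real.negMulLog x ≤ -Real.log q * x := by
      rw [Real.negMulLog]; nlinarith
    have h3 : 0 ≤ c * min x q := mul_nonneg hc (le_min hx0.le hq0.le)
    linarith [Real.exp_pos (-c)]

lemma IsState.vonNeumannEntropy_ge {ρ : Matrix m m ℂ} (h : IsState ρ) {q : ℝ} (hq0 : 0 < q)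
    (hq1 : q ≤ 1) : -Real.log q * (1 - 2 * excess ρ (q / 2)) ≤ vonNeumannEntropy ρ := by
  rw [vonNeumannEntropy_eq h.1.1, excess_eq_sum h.1.1, ← h.sum_eigenvalues, Finset.mul_sum,
    ← Finset.sum_sub_distrib, Finset.mul_sum]
  exact Finset.sum_le_sum fun i _ =>
    negMulLog_ge (h.1.eigenvalues_nonneg i) (h.eigenvalues_le_one i) hq0 hq1

lemma IsState.vonNeumannEntropy_le {ρ : Matrix m m ℂ} (h : IsState ρ) {q c : ℝ} (hq0 : 0 < q)
    (hq1 : q ≤ 1) (hc : 0 ≤ c) :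
    vonNeumannEntropy ρ ≤ -Real.log q + c * (1 - excess ρ q) + ρ.rank * Real.exp (-c) := by
  have hr : (ρ.rank : ℝ) * Real.exp (-c) =
      ∑ i, if h.1.1.eigenvalues i = 0 then 0 else Real.exp (-c) := by
    rw [h.1.1.rank_eq_card_non_zero_eigs, Fintype.card_subtype, Finset.sum_ite]
    simp
  rw [vonNeumannEntropy_eq h.1.1, ← h.sum_min, hr, Finset.mul_sum, ← mul_one (-Real.log q),
    ← h.sum_eigenvalues, Finset.mul_sum, ← Finset.sum_add_distrib, ← Finset.sum_add_distrib]
  exact Finset.sum_le_sum fun i _ => negMulLog_le (h.1.eigenvalues_nonneg i) hq0 hq1 hc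

lemma IsState.one_sub_excess_le {ρ : Matrix m m ℂ} (h : IsState ρ) (q : ℝ) :
    1 - excess ρ q ≤ ρ.rank * q := by
  rw [← h.sum_min, h.1.1.rank_eq_card_non_zero_eigs, Fintype.card_subtype, ← nsmul_eq_mul,
    ← Finset.sum_const, Finset.sum_filter]
  refine Finset.sum_le_sum fun i _ => ?_
  split_ifs with hi
  · exact min_le_right _ _
  · rw [not_not.1 hi]; exact min_le_left _ _

lemma IsState.excess_one {ρ : Matrix m m ℂ} (h : IsState ρ) : excess ρ 1 = 0 := by
  rw [excess_eq_sum h.1.1]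
  exact Finset.sum_eq_zero fun i _ => max_eq_right (sub_nonpos.2 (h.eigenvalues_le_one i))

end Entropy

/-! ### Asymptotics of the entropy per copy -/

section EntropyRate

variable {ι : ℕ → Type} [∀ n, Fintype (ι n)] [∀ n, DecidableEq (ι n)]

lemma infEntropyRate_nonneg {ρ : ∀ n, Matrix (ι n) (ι n) ℂ} (hρ : ∀ n, 1 ≤ n → IsState (ρ n)) :
    0 ≤ infEntropyRate ρ := by
  rw [infEntropyRate_eq hρ]
  refine EReal.le_neg_of_le_neg ?_
  rw [neg_zero]
  refine sInf_le ⟨0, ?_, rfl⟩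
  refine (tendsto_congr' ?_).2 tendsto_const_nhds
  filter_upwards [eventually_ge_atTop 1] with n hn
  rw [mul_zero, Real.exp_zero, (hρ n hn).excess_one]

lemma one_le_of_rank_le {ρ : ∀ n, Matrix (ι n) (ι n) ℂ} (hρ : ∀ n, 1 ≤ n → IsState (ρ n)) {d : ℕ}
    (hd : ∀ n, 1 ≤ n → (ρ n).rank ≤ d ^ n) : 1 ≤ d := by
  by_contra h
  have h0 : d = 0 := by omega
  have h1 := hd 1 le_rfl
  rw [h0, pow_one, Nat.le_zero] at h1
  have h2 := (hρ 1 le_rfl).one_sub_excess_le 1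
  rw [h1, (hρ 1 le_rfl).excess_one] at h2
  norm_num at h2

lemma exp_nat_mul_log {d : ℕ} (hd : 1 ≤ d) (n : ℕ) :
    Real.exp (n * Real.log d) = (d : ℝ) ^ n := by
  rw [Real.exp_nat_mul, Real.exp_log (by exact_mod_cast hd)]

lemma supEntropyRate_le {ρ : ∀ n, Matrix (ι n) (ι n) ℂ} (hρ : ∀ n, 1 ≤ n → IsState (ρ n)) {d : ℕ}
    (hd : ∀ n, 1 ≤ n → (ρ n).rank ≤ d ^ n) :
    supEntropyRate ρ ≤ ((Real.log d + 1 : ℝ) : EReal) := by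
  have hd1 := one_le_of_rank_le hρ hd
  rw [supEntropyRate_eq hρ]
  refine EReal.neg_le_of_neg_le ?_
  rw [← EReal.coe_neg]
  -- The threshold is -(log d + 1); the extra 1 is slack making rank · q decay like e^{-n}. Only
  -- finiteness matters here.
  refine le_sSup ⟨_, ?_, rfl⟩
  have h0 : Tendsto (fun n : ℕ => 1 - excess (ρ n) (Real.exp (n * -(Real.log d + 1)))) atTop
      (𝓝 0) := by
    refine squeeze_zero' (eventually_atTop.2 ⟨1, fun n hn => sub_nonneg.2 <|
      (hρ n hn).excess_le_one (Real.exp_pos _).le⟩) (eventually_atTop.2 ⟨1, fun n hn => ?_⟩)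
      (tendsto_exp_nat_mul_neg (show (-1 : ℝ) < 0 by norm_num))
    refine ((hρ n hn).one_sub_excess_le _).trans ?_
    have h1 : ((ρ n).rank : ℝ) ≤ Real.exp (n * Real.log d) := by
      rw [exp_nat_mul_log hd1]; exact_mod_cast hd n hn
    calc ((ρ n).rank : ℝ) * Real.exp (n * -(Real.log d + 1))
        ≤ Real.exp (n * Real.log d) * Real.exp (n * -(Real.log d + 1)) := by gcongr
      _ = Real.exp (n * -1) := by rw [← Real.exp_add]; congr 1; ring
  simpa using h0.const_sub 1

lemma eventually_le_entropy {ρ : ∀ n, Matrix (ι n) (ι n) ℂ} (hρ : ∀ n, 1 ≤ n → IsState (ρ n))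
    {a E : ℝ} (hE : infEntropyRate ρ = E) (ha : a < E) :
    ∀ᶠ n : ℕ in atTop, a < 1 / (n : ℝ) * vonNeumannEntropy (ρ n) := by
  -- Negative a is settled by nonnegativity of the entropy; otherwise b > 0, so the cutoff e^{-nb}
  -- is at most 1.
  rcases lt_or_ge a 0 with ha0 | ha0
  · filter_upwards [eventually_ge_atTop 1] with n hn
    exact ha0.trans_le (mul_nonneg (by positivity) (hρ n hn).vonNeumannEntropy_nonneg)
  obtain ⟨b, hab, hbE⟩ := exists_between ha
  -- The gap between b and b' absorbs the factor 1/2 in the cutoff q/2 of the entropy bound.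
  obtain ⟨b', hbb', hb'E⟩ := exists_between hbE
  have h1 := tendsto_excess_zero_of_infEntropyRate hρ (γ := -b')
    (by rw [hE, neg_neg]; exact_mod_cast hb'E)
  have h2 : Tendsto (fun n : ℕ => b * (1 - 2 * excess (ρ n) (Real.exp (n * -b')))) atTop
      (𝓝 b) := by
    simpa using ((h1.const_mul 2).const_sub 1).const_mul b
  have h3 := (tendsto_exp_nat_mul_neg (show b - b' < 0 by linarith)).eventually
    (ge_mem_nhds (show (0 : ℝ) < 1 / 2 by norm_num))
  filter_upwards [h2.eventually (lt_mem_nhds hab), h3, eventually_ge_atTop 1] with n hn hn3 hn1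
  have hn0 : (0 : ℝ) < n := by exact_mod_cast hn1
  refine hn.trans_le ?_
  have h4 := (hρ n hn1).vonNeumannEntropy_ge (Real.exp_pos (n * -b))
    (Real.exp_le_one_iff.2 (by nlinarith))
  rw [Real.log_exp] at h4
  have h5 : Real.exp (n * -b') ≤ Real.exp (n * -b) / 2 := by
    calc Real.exp (n * -b') = Real.exp (n * -b) * Real.exp (n * (b - b')) := by
          rw [← Real.exp_add]; congr 1; ring
      _ ≤ Real.exp (n * -b) * (1 / 2) := by gcongr
      _ = _ := by ring
  have h6 := (hρ n hn1).excess_anti h5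
  rw [one_div_mul_eq_div, le_div_iff₀ hn0]
  have h7 : (n : ℝ) * b * (1 - 2 * excess (ρ n) (Real.exp (n * -b'))) ≤
      n * b * (1 - 2 * excess (ρ n) (Real.exp (n * -b) / 2)) :=
    mul_le_mul_of_nonneg_left (by linarith) (mul_nonneg hn0.le (by linarith))
  linarith

/-- With slope c = n log d the rank term is at most 1, while c(1 - excess)/n tends to 0. -/
lemma eventually_entropy_le {ρ : ∀ n, Matrix (ι n) (ι n) ℂ} (hρ : ∀ n, 1 ≤ n → IsState (ρ n))
    {d : ℕ} (hd : ∀ n, 1 ≤ n → (ρ n).rank ≤ d ^ n) {a E : ℝ} (hE0 : 0 ≤ E)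
    (hE : supEntropyRate ρ = E) (ha : E < a) :
    ∀ᶠ n : ℕ in atTop, 1 / (n : ℝ) * vonNeumannEntropy (ρ n) < a := by
  have hd1 := one_le_of_rank_le hρ hd
  obtain ⟨b, hEb, hba⟩ := exists_between ha
  have h1 := tendsto_excess_one_of_supEntropyRate hρ (γ := -b)
    (by rw [hE, neg_neg]; exact_mod_cast hEb)
  have h2 : Tendsto (fun n : ℕ => b + Real.log d * (1 - excess (ρ n) (Real.exp (n * -b))) +
      1 / (n : ℝ)) atTop (𝓝 b) := by
    simpa using (((h1.const_sub 1).const_mul (Real.log d)).const_add b).add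
      tendsto_one_div_atTop_nhds_zero_nat
  filter_upwards [h2.eventually (gt_mem_nhds hba), eventually_ge_atTop 1] with n hn hn1
  have hn0 : (0 : ℝ) < n := by exact_mod_cast hn1
  refine lt_of_le_of_lt ?_ hn
  have h4 := (hρ n hn1).vonNeumannEntropy_le (c := n * Real.log d) (Real.exp_pos (n * -b))
    (Real.exp_le_one_iff.2 (by nlinarith))
    (mul_nonneg hn0.le (Real.log_nonneg (by exact_mod_cast hd1)))
  have h5 : ((ρ n).rank : ℝ) * Real.exp (-(n * Real.log d)) ≤ 1 := by
    rw [Real.exp_neg, exp_nat_mul_log hd1, ← div_eq_mul_inv]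
    exact div_le_one_of_le₀ (by exact_mod_cast hd n hn1) (by positivity)
  rw [Real.log_exp] at h4
  rw [one_div_mul_eq_div, div_le_iff₀ hn0, add_mul, one_div_mul_cancel hn0.ne']
  linarith

theorem exists_entropyRate {ρ : ∀ n, Matrix (ι n) (ι n) ℂ} (hρ : ∀ n, 1 ≤ n → IsState (ρ n))
    {d : ℕ} (hd : ∀ n, 1 ≤ n → (ρ n).rank ≤ d ^ n) (h : infEntropyRate ρ = supEntropyRate ρ) :
    ∃ E : ℝ, infEntropyRate ρ = E ∧
      Tendsto (fun n : ℕ => 1 / (n : ℝ) * vonNeumannEntropy (ρ n)) atTop (𝓝 E) := by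
  have h0 := infEntropyRate_nonneg hρ
  have h1 := supEntropyRate_le hρ hd
  rw [← h] at h1
  obtain ⟨E, hE⟩ : ∃ E : ℝ, infEntropyRate ρ = E :=
    ⟨_, (EReal.coe_toReal (h1.trans_lt (EReal.coe_lt_top _)).ne
      ((EReal.bot_lt_zero).trans_le h0).ne').symm⟩
  refine ⟨E, hE, tendsto_order.2 ⟨fun a ha => eventually_le_entropy hρ hE ha, fun a ha =>
    eventually_entropy_le hρ hd ?_ (h ▸ hE) ha⟩⟩
  rw [hE] at h0
  exact_mod_cast h0

end EntropyRate

/-! ### Tensor powers -/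

section TensorPower

variable {ι : Type} [Fintype ι] [DecidableEq ι]

lemma tensorPower_mul (X Y : Matrix ι ι ℂ) (n : ℕ) :
    tensorPower (X * Y) n = tensorPower X n * tensorPower Y n := by
  ext i j
  simp only [tensorPower, of_apply, mul_apply, ← Finset.prod_mul_distrib]
  rw [Finset.prod_univ_sum, Fintype.piFinset_univ]

lemma tensorPower_conjTranspose (X : Matrix ι ι ℂ) (n : ℕ) :
    (tensorPower X n)ᴴ = tensorPower Xᴴ n := by
  ext i j
  simp [tensorPower, conjTranspose_apply]

lemma tensorPower_diagonal (d : ι → ℂ) (n : ℕ) :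
    tensorPower (diagonal d) n = diagonal fun i : Fin n → ι => ∏ k, d (i k) := by
  ext i j
  rw [tensorPower, of_apply, diagonal_apply]
  split_ifs with h
  · subst h; simp
  · obtain ⟨k, hk⟩ := Function.ne_iff.1 h
    exact Finset.prod_eq_zero (Finset.mem_univ k) (diagonal_apply_ne _ hk)

lemma tensorPower_one (n : ℕ) : tensorPower (1 : Matrix ι ι ℂ) n = 1 := by
  rw [← diagonal_one, tensorPower_diagonal]
  simp

lemma IsState.tensorPower {σ : Matrix ι ι ℂ} (h : IsState σ) (n : ℕ) :
    IsState (tensorPower σ n) := by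
  constructor
  · open scoped MatrixOrder in
    obtain ⟨B, rfl⟩ := CStarAlgebra.nonneg_iff_eq_star_mul_self.mp h.1.nonneg
    rw [star_eq_conjTranspose, tensorPower_mul, ← tensorPower_conjTranspose]
    exact posSemidef_conjTranspose_mul_self _
  · have := Fintype.sum_pow (fun i => σ i i) n
    rw [show ∑ i, σ i i = 1 from h.2, one_pow] at this
    exact this.symm

/-- The tensor power of a diagonalising unitary diagonalises the tensor power, with the n-fold
products as eigenvalues. -/
lemma sum_eigenvalues_tensorPower {σ : Matrix ι ι ℂ} (h : IsState σ) (n : ℕ) {f : ℝ → ℝ}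
    (hf : f 0 = 0) :
    ∑ i, f ((h.tensorPower n).1.1.eigenvalues i) =
      ∑ i : Fin n → ι, f (∏ k, h.1.1.eigenvalues (i k)) := by
  refine sum_eigenvalues_conj (V := BipartiteEntanglement.tensorPower
    (h.1.1.eigenvectorUnitary : Matrix ι ι ℂ) n) _ ?_ ?_ hf
  · rw [tensorPower_conjTranspose, ← tensorPower_mul, conjTranspose_mul_eigenvectorUnitary,
      tensorPower_one]
  · conv_lhs => rw [spectral_decomposition h.1.1]
    rw [tensorPower_mul, tensorPower_mul, tensorPower_conjTranspose, tensorPower_diagonal]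
    push_cast
    rfl

/-- The power sum `∑ λ ^ (1 + s)` of the eigenvalues. -/
def powerSum {σ : Matrix ι ι ℂ} (h : IsState σ) (s : ℝ) : ℝ :=
  ∑ i, h.1.1.eigenvalues i ^ (1 + s)

lemma powerSum_zero {σ : Matrix ι ι ℂ} (h : IsState σ) : powerSum h 0 = 1 := by
  simp [powerSum, h.sum_eigenvalues]

lemma powerSum_nonneg {σ : Matrix ι ι ℂ} (h : IsState σ) (s : ℝ) : 0 ≤ powerSum h s :=
  Finset.sum_nonneg fun i _ => Real.rpow_nonneg (h.1.eigenvalues_nonneg i) _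

lemma hasDerivAt_rpow_one_add {x : ℝ} (hx : 0 ≤ x) :
    HasDerivAt (fun s : ℝ => x ^ (1 + s)) (-Real.negMulLog x) 0 := by
  -- At x = 0 the function vanishes for s > -1, matching the convention 0 log 0 = 0.
  rcases hx.eq_or_lt with rfl | hx
  · rw [Real.negMulLog_zero, neg_zero]
    refine (hasDerivAt_const (0 : ℝ) (0 : ℝ)).congr_of_eventuallyEq ?_
    filter_upwards [lt_mem_nhds (show (-1 : ℝ) < 0 by norm_num)] with s hs
    exact Real.zero_rpow (by linarith)
  · refine (((hasDerivAt_id (0 : ℝ)).const_add 1).const_rpow hx).congr_deriv ?_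
    rw [Real.negMulLog, id, add_zero, Real.rpow_one]
    ring

lemma hasDerivAt_powerSum {σ : Matrix ι ι ℂ} (h : IsState σ) :
    HasDerivAt (powerSum h) (-vonNeumannEntropy σ) 0 := by
  rw [vonNeumannEntropy_eq h.1.1, ← Finset.sum_neg_distrib]
  have := HasDerivAt.fun_sum (u := Finset.univ)
    fun i _ => hasDerivAt_rpow_one_add (h.1.eigenvalues_nonneg i)
  exact this

lemma sum_rpow_tensorPower {σ : Matrix ι ι ℂ} (h : IsState σ) (n : ℕ) (s : ℝ) :
    ∑ i : Fin n → ι, (∏ k, h.1.1.eigenvalues (i k)) ^ (1 + s) = powerSum h s ^ n := by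
  rw [powerSum, Fintype.sum_pow]
  exact Finset.sum_congr rfl fun i _ =>
    (Real.finsetProd_rpow _ _ (fun k _ => h.1.eigenvalues_nonneg _) _).symm

/-- A Chernoff-type bound: when x > q the factor (x/q)^s is at least 1. -/
lemma max_sub_le_rpow {x q s : ℝ} (hx : 0 ≤ x) (hq : 0 < q) (hs : 0 < s) :
    max (x - q) 0 ≤ x ^ (1 + s) * q ^ (-s) := by
  rcases le_or_gt x q with h | h
  · rw [max_eq_right (by linarith)]; positivity
  · have hx0 : 0 < x := hq.trans h
    rw [max_eq_left (by linarith), Real.rpow_add hx0, Real.rpow_one, mul_assoc, Real.rpow_neg hq.le,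
      ← div_eq_mul_inv, ← Real.div_rpow hx hq.le]
    have : 1 ≤ (x / q) ^ s := Real.one_le_rpow ((one_le_div hq).2 h.le) hs.le
    nlinarith

/-- The companion for negative s: both exponents 1 + s and -s are nonnegative, so min(x, q) may be
replaced by x in one factor and by q in the other. -/
lemma min_le_rpow {x q s : ℝ} (hx : 0 ≤ x) (hq : 0 < q) (hs : s < 0) (hs1 : -1 < s) :
    min x q ≤ x ^ (1 + s) * q ^ (-s) := by
  have h1 : 0 ≤ min x q := le_min hx hq.le
  calc min x q = min x q ^ (1 + s) * min x q ^ (-s) := by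
        rw [← Real.rpow_add' h1 (by simp)]; simp
    _ ≤ x ^ (1 + s) * q ^ (-s) := by
        gcongr
        · linarith
        · exact min_le_left _ _
        · linarith
        · exact min_le_right _ _

lemma excess_tensorPower_le {σ : Matrix ι ι ℂ} (h : IsState σ) (n : ℕ) {q s : ℝ} (hq : 0 < q)
    (hs : 0 < s) : excess (tensorPower σ n) q ≤ powerSum h s ^ n * q ^ (-s) := by
  rw [excess_eq_sum (h.tensorPower n).1.1,
    sum_eigenvalues_tensorPower h n (f := fun x => max (x - q) 0) (by simpa using hq.le),
    ← sum_rpow_tensorPower, Finset.sum_mul]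
  exact Finset.sum_le_sum fun i _ =>
    max_sub_le_rpow (Finset.prod_nonneg fun k _ => h.1.eigenvalues_nonneg _) hq hs

lemma one_sub_excess_tensorPower_le {σ : Matrix ι ι ℂ} (h : IsState σ) (n : ℕ) {q s : ℝ}
    (hq : 0 < q) (hs : s < 0) (hs1 : -1 < s) :
    1 - excess (tensorPower σ n) q ≤ powerSum h s ^ n * q ^ (-s) := by
  rw [← (h.tensorPower n).sum_min,
    sum_eigenvalues_tensorPower h n (f := fun x => min x q) (by simpa using hq.le),
    ← sum_rpow_tensorPower, Finset.sum_mul]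
  exact Finset.sum_le_sum fun i _ =>
    min_le_rpow (Finset.prod_nonneg fun k _ => h.1.eigenvalues_nonneg _) hq hs hs1

lemma powerSum_pow_mul_exp {σ : Matrix ι ι ℂ} (h : IsState σ) (n : ℕ) (γ s : ℝ) :
    powerSum h s ^ n * Real.exp (n * γ) ^ (-s) = (powerSum h s * Real.exp (-(γ * s))) ^ n := by
  rw [mul_pow, ← Real.exp_mul, ← Real.exp_nat_mul]
  congr 2; ring

lemma hasDerivAt_powerSum_mul_exp {σ : Matrix ι ι ℂ} (h : IsState σ) (γ : ℝ) :
    HasDerivAt (fun s => powerSum h s * Real.exp (-(γ * s))) (-vonNeumannEntropy σ - γ) 0 := by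
  have h1 : HasDerivAt (fun s : ℝ => Real.exp (-(γ * s))) (-γ) 0 := by
    have := (((hasDerivAt_id (0 : ℝ)).const_mul γ).neg).exp
    simpa using this
  refine ((hasDerivAt_powerSum h).mul h1).congr_deriv ?_
  rw [powerSum_zero, mul_zero, neg_zero, Real.exp_zero]
  ring

/-- The base `powerSum h s * exp (-(γ * s))` equals 1 at s = 0 with slope -S(σ) - γ < 0. It is below
1 for some s > 0, and the excess is bounded by its n-th power. -/
lemma tendsto_excess_tensorPower_zero {σ : Matrix ι ι ℂ} (h : IsState σ) {γ : ℝ}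
    (hγ : -vonNeumannEntropy σ < γ) :
    Tendsto (fun n : ℕ => excess (tensorPower σ n) (Real.exp (n * γ))) atTop (𝓝 0) := by
  have hd := hasDerivAt_powerSum_mul_exp h γ
  obtain ⟨s, hs0, hs⟩ : ∃ s : ℝ, 0 < s ∧ powerSum h s * Real.exp (-(γ * s)) < 1 := by
    have h1 := (hasDerivAt_iff_tendsto_slope.1 hd).eventually
      (gt_mem_nhds (show -vonNeumannEntropy σ - γ < 0 by linarith))
    have h2 := h1.filter_mono (nhdsGT_le_nhdsNE 0)
    obtain ⟨s, h3, h4⟩ := (h2.and self_mem_nhdsWithin).exists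
    refine ⟨s, h4, ?_⟩
    rw [slope_def_field, sub_zero, div_lt_iff₀ h4, zero_mul] at h3
    simpa [powerSum_zero] using h3
  refine squeeze_zero (fun n => (h.tensorPower n).excess_nonneg _) (fun n => ?_)
    (tendsto_pow_atTop_nhds_zero_of_lt_one
      (mul_nonneg (powerSum_nonneg h s) (Real.exp_pos _).le) hs)
  rw [← powerSum_pow_mul_exp]
  exact excess_tensorPower_le h n (Real.exp_pos _) hs0

/-- Here the slope at 0 is positive, so a small negative s makes the base less than 1 and 1 - excess
decays. -/
lemma tendsto_excess_tensorPower_one {σ : Matrix ι ι ℂ} (h : IsState σ) {γ : ℝ}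
    (hγ : γ < -vonNeumannEntropy σ) :
    Tendsto (fun n : ℕ => excess (tensorPower σ n) (Real.exp (n * γ))) atTop (𝓝 1) := by
  have hd := hasDerivAt_powerSum_mul_exp h γ
  obtain ⟨s, hs0, hs1, hs⟩ :
      ∃ s : ℝ, s < 0 ∧ -1 < s ∧ powerSum h s * Real.exp (-(γ * s)) < 1 := by
    have h1 := (hasDerivAt_iff_tendsto_slope.1 hd).eventually
      (lt_mem_nhds (show 0 < -vonNeumannEntropy σ - γ by linarith))
    have h2 := h1.filter_mono (nhdsLT_le_nhdsNE 0)
    have h5 : ∀ᶠ s in 𝓝[<] (0 : ℝ), -1 < s :=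
      (lt_mem_nhds (show (-1 : ℝ) < 0 by norm_num)).filter_mono nhdsWithin_le_nhds
    obtain ⟨s, ⟨h3, h6⟩, h4⟩ := ((h2.and h5).and self_mem_nhdsWithin).exists
    refine ⟨s, h4, h6, ?_⟩
    rw [slope_def_field, sub_zero, lt_div_iff_of_neg h4, zero_mul] at h3
    simpa [powerSum_zero] using h3
  have h0 : Tendsto (fun n : ℕ => 1 - excess (tensorPower σ n) (Real.exp (n * γ))) atTop
      (𝓝 0) := by
    refine squeeze_zero (fun n => sub_nonneg.2 <|
      (h.tensorPower n).excess_le_one (Real.exp_pos _).le) (fun n => ?_)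
      (tendsto_pow_atTop_nhds_zero_of_lt_one
        (mul_nonneg (powerSum_nonneg h s) (Real.exp_pos _).le) hs)
    rw [← powerSum_pow_mul_exp]
    exact one_sub_excess_tensorPower_le h n (Real.exp_pos _) hs0 hs1
  simpa using h0.const_sub 1

end TensorPower

/-! ### Mixtures -/

section Mixture

variable {m : Type} [Fintype m] [DecidableEq m] {σ ω : Matrix m m ℂ} {t : ℝ}

lemma re_trace_mul_mix (P : Matrix m m ℂ) :
    (P * ((t : ℂ) • σ + ((1 - t : ℝ) : ℂ) • ω)).trace.re =
      t * (P * σ).trace.re + (1 - t) * (P * ω).trace.re := by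
  rw [Matrix.mul_add, Matrix.mul_smul, Matrix.mul_smul, trace_add, trace_smul, trace_smul,
    Complex.add_re, smul_eq_mul, smul_eq_mul, Complex.re_ofReal_mul, Complex.re_ofReal_mul]

lemma IsState.mix (hσ : IsState σ) (hω : IsState ω) (h0 : 0 ≤ t) (h1 : t ≤ 1) :
    IsState ((t : ℂ) • σ + ((1 - t : ℝ) : ℂ) • ω) := by
  refine ⟨(hσ.1.smul ?_).add (hω.1.smul ?_), ?_⟩
  · exact_mod_cast h0
  · exact_mod_cast sub_nonneg.2 h1
  · rw [trace_add, trace_smul, trace_smul, hσ.2, hω.2]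
    simp

/-- The excess is a maximum of functionals affine in ρ, hence convex. -/
lemma excess_mix_le (hσ : IsState σ) (hω : IsState ω) (h0 : 0 ≤ t) (h1 : t ≤ 1) (q : ℝ) :
    excess ((t : ℂ) • σ + ((1 - t : ℝ) : ℂ) • ω) q ≤ t * excess σ q + (1 - t) * excess ω q := by
  obtain ⟨P, hP, -, h⟩ := exists_spectralProj (hσ.mix hω h0 h1).1.1 q
  rw [← h, re_trace_mul_mix]
  have h2 := mul_le_mul_of_nonneg_left (hP.trace_mul_le_excess hσ.1.1 q) h0
  have h3 := mul_le_mul_of_nonneg_left (hP.trace_mul_le_excess hω.1.1 q) (sub_nonneg.2 h1)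
  linarith

/-- The optimal projection for σ is tested on the mixture and the positive ω-term discarded;
weighting by t rescales the cutoff to q/t. -/
lemma le_excess_mix (hσ : IsState σ) (hω : IsState ω) (h0 : 0 < t) (h1 : t ≤ 1) (q : ℝ) :
    t * excess σ (q / t) ≤ excess ((t : ℂ) • σ + ((1 - t : ℝ) : ℂ) • ω) q := by
  obtain ⟨P, hP, -, h⟩ := exists_spectralProj hσ.1.1 (q / t)
  refine le_trans ?_ (hP.trace_mul_le_excess (hσ.mix hω h0.le h1).1.1 q)
  rw [← h, re_trace_mul_mix, mul_sub, ← mul_assoc, mul_div_cancel₀ _ h0.ne']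
  have h2 := mul_nonneg (sub_nonneg.2 h1) (trace_mul_nonneg_of_posSemidef hP.posSemidef hω.1)
  linarith

lemma rank_add_le (X Y : Matrix m m ℂ) : (X + Y).rank ≤ X.rank + Y.rank := by
  rw [rank, rank, rank, mulVecLin_add]
  exact (Submodule.finrank_mono (LinearMap.range_add_le _ _)).trans
    (Submodule.finrank_add_le_finrank_add_finrank _ _)

lemma IsOrthProj.trace_mul_le_of_mul_eq {P Q : Matrix m m ℂ} (hP : IsOrthProj P)
    (hQ : IsOrthProj Q) (h : P * Q = Q) (hσ : IsState σ) :
    (Q * σ).trace.re ≤ (P * σ).trace.re := by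
  have h' : Q * P = Q := by
    have := congrArg conjTranspose h
    rwa [conjTranspose_mul, hP.isHermitian, hQ.isHermitian] at this
  have hPQ : IsOrthProj (P - Q) := ⟨hP.isHermitian.sub hQ.isHermitian, by
    rw [Matrix.sub_mul, Matrix.mul_sub, Matrix.mul_sub, hP.mul_self, hQ.mul_self, h, h']; simp⟩
  have := trace_mul_nonneg_of_posSemidef hPQ.posSemidef hσ.1
  rw [Matrix.sub_mul, trace_sub, Complex.sub_re] at this
  linarith

/-- The projection onto the span of the ranges of two projections. -/
lemma exists_sup_orthProj {Q Q' : Matrix m m ℂ} (hQ : IsOrthProj Q) (hQ' : IsOrthProj Q') :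
    ∃ P : Matrix m m ℂ, IsOrthProj P ∧ P * Q = Q ∧ P * Q' = Q' ∧
      P.trace.re ≤ Q.rank + Q'.rank := by
  obtain ⟨P, hP, hPr, hPX⟩ := exists_rangeProj (fromCols Q Q')
  rw [mul_fromCols] at hPX
  replace hPX := fromCols_inj hPX
  refine ⟨P, hP, hPX.1, hPX.2, ?_⟩
  -- The block matrix [Q Q'] has the rank of QQᴴ + Q'Q'ᴴ = Q + Q'.
  rw [hPr, ← rank_self_mul_conjTranspose, conjTranspose_fromCols_eq_fromRows_conjTranspose,
    fromCols_mul_fromRows, hQ.isHermitian, hQ'.isHermitian, hQ.mul_self, hQ'.mul_self]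
  exact_mod_cast rank_add_le Q Q'

lemma IsState.exists_spectralProj {ρ : Matrix m m ℂ} (h : IsState ρ) {q : ℝ} (hq : 0 < q) :
    ∃ P : Matrix m m ℂ, IsOrthProj P ∧ (P.rank : ℝ) ≤ 1 / q ∧ excess ρ q ≤ (P * ρ).trace.re := by
  obtain ⟨P, hP, hr, he⟩ := BipartiteEntanglement.exists_spectralProj h.1.1 q
  have h1 := trace_mul_nonneg_of_posSemidef hP.one_sub.posSemidef h.1
  rw [Matrix.sub_mul, Matrix.one_mul, trace_sub, Complex.sub_re, h.2, Complex.one_re] at h1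
  have h2 : 0 ≤ q * P.trace.re := mul_nonneg hq.le ((Nat.cast_nonneg _).trans hr)
  refine ⟨P, hP, ?_, by linarith⟩
  rw [le_div_iff₀ hq, mul_comm]
  have h3 := mul_le_mul_of_nonneg_left hr hq.le
  have h4 := h.excess_nonneg q
  linarith

/-- One projection containing the spectral projections of both σ and ω at level q' is tested. Its
rank is at most 2/q', which costs 2q/q' at level q. -/
lemma le_excess_mix_of_le (hσ : IsState σ) (hω : IsState ω) (h0 : 0 ≤ t) (h1 : t ≤ 1)
    {q q' : ℝ} (hq : 0 ≤ q) (hq' : 0 < q') :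
    t * excess σ q' + (1 - t) * excess ω q' - 2 * (q / q') ≤
      excess ((t : ℂ) • σ + ((1 - t : ℝ) : ℂ) • ω) q := by
  obtain ⟨Q, hQ, hQr, hQe⟩ := hσ.exists_spectralProj hq'
  obtain ⟨Q', hQ', hQr', hQe'⟩ := hω.exists_spectralProj hq'
  obtain ⟨P, hP, hPQ, hPQ', hPr⟩ := exists_sup_orthProj hQ hQ'
  refine le_trans ?_ (hP.trace_mul_le_excess (hσ.mix hω h0 h1).1.1 q)
  rw [re_trace_mul_mix]
  have h2 := mul_le_mul_of_nonneg_left (hQe.trans (hP.trace_mul_le_of_mul_eq hQ hPQ hσ)) h0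
  have h3 := mul_le_mul_of_nonneg_left (hQe'.trans (hP.trace_mul_le_of_mul_eq hQ' hPQ' hω))
    (sub_nonneg.2 h1)
  have h4 : q * P.trace.re ≤ q * (1 / q' + 1 / q') :=
    mul_le_mul_of_nonneg_left (hPr.trans (add_le_add hQr hQr')) hq
  have h5 : q * (1 / q' + 1 / q') = 2 * (q / q') := by ring
  linarith

end Mixture

/-! ### Spectral rates of mixtures of tensor powers, and purifications -/

section MixedPower

variable {ι : Type} [Fintype ι] [DecidableEq ι] {σ ω : Matrix ι ι ℂ} {t : ℝ}

lemma isState_mixedPower (hσ : IsState σ) (hω : IsState ω) (h0 : 0 < t) (h1 : t < 1) (n : ℕ) :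
    IsState (mixedPower t σ ω n) :=
  (hσ.tensorPower n).mix (hω.tensorPower n) h0.le h1.le

/-- Above -S(σ) both components lose their excess; below it the σ-component alone keeps the limit at
least t > 0. -/
lemma infEntropyRate_mixedPower (hσ : IsState σ) (hω : IsState ω) (h0 : 0 < t) (h1 : t < 1)
    (hS : vonNeumannEntropy σ < vonNeumannEntropy ω) :
    infEntropyRate (mixedPower t σ ω) = vonNeumannEntropy σ := by
  refine infEntropyRate_eq_coe (fun n _ => isState_mixedPower hσ hω h0 h1 n) (fun γ hγ => ?_)
    fun γ hγ h => ?_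
  · have h2 := ((tendsto_excess_tensorPower_zero hσ hγ).const_mul t).add
      ((tendsto_excess_tensorPower_zero hω (show -vonNeumannEntropy ω < γ by linarith)).const_mul
        (1 - t))
    rw [mul_zero, mul_zero, add_zero] at h2
    exact squeeze_zero (fun n => (isState_mixedPower hσ hω h0 h1 n).excess_nonneg _)
      (fun n => excess_mix_le (hσ.tensorPower n) (hω.tensorPower n) h0.le h1.le _) h2
  · obtain ⟨γ', hγγ', hγ'⟩ := exists_between hγ
    have h2 := (tendsto_excess_tensorPower_one hσ hγ').const_mul t
    -- Eventually e^{n(γ-γ')} ≤ t, so the rescaled cutoff e^{nγ}/t stays below e^{nγ'}.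
    have h3 := (tendsto_exp_nat_mul_neg (show γ - γ' < 0 by linarith)).eventually (ge_mem_nhds h0)
    have h4 : t * 1 ≤ 0 := by
      refine le_of_tendsto_of_tendsto h2 h ?_
      filter_upwards [h3] with n hn
      refine le_trans ?_ (le_excess_mix (hσ.tensorPower n) (hω.tensorPower n) h0 h1.le _)
      refine mul_le_mul_of_nonneg_left ((hσ.tensorPower n).excess_anti ?_) h0.le
      rw [div_le_iff₀ h0]
      calc Real.exp (n * γ) = Real.exp (n * γ') * Real.exp (n * (γ - γ')) := by
            rw [← Real.exp_add]; congr 1; ring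
        _ ≤ _ := by gcongr
    linarith

/-- Below -S(ω) both components have full excess; above it the ω-component vanishes and the limit
cannot exceed t < 1. -/
lemma supEntropyRate_mixedPower (hσ : IsState σ) (hω : IsState ω) (h0 : 0 < t) (h1 : t < 1)
    (hS : vonNeumannEntropy σ < vonNeumannEntropy ω) :
    supEntropyRate (mixedPower t σ ω) = vonNeumannEntropy ω := by
  refine supEntropyRate_eq_coe (fun n _ => isState_mixedPower hσ hω h0 h1 n) (fun γ hγ => ?_)
    fun γ hγ h => ?_
  · obtain ⟨γ', hγγ', hγ'⟩ := exists_between hγ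
    have h2 := (((tendsto_excess_tensorPower_one hσ
      (show γ' < -vonNeumannEntropy σ by linarith)).const_mul t).add
      ((tendsto_excess_tensorPower_one hω hγ').const_mul (1 - t))).sub
      ((tendsto_exp_nat_mul_neg (show γ - γ' < 0 by linarith)).const_mul 2)
    rw [show t * 1 + (1 - t) * 1 - 2 * 0 = 1 by ring] at h2
    refine tendsto_of_tendsto_of_tendsto_of_le_of_le h2 tendsto_const_nhds (fun n => ?_)
      fun n => (isState_mixedPower hσ hω h0 h1 n).excess_le_one (Real.exp_pos _).le
    have h3 := le_excess_mix_of_le (hσ.tensorPower n) (hω.tensorPower n) h0.le h1.le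
      (Real.exp_pos (n * γ)).le (Real.exp_pos (n * γ'))
    rw [← Real.exp_sub, ← mul_sub] at h3
    exact h3
  · have h2 := ((tendsto_excess_tensorPower_zero hω hγ).const_mul (1 - t)).const_add t
    have h4 : 1 ≤ t + (1 - t) * 0 := by
      refine le_of_tendsto_of_tendsto h h2 (Eventually.of_forall fun n => ?_)
      refine (excess_mix_le (hσ.tensorPower n) (hω.tensorPower n) h0.le h1.le _).trans ?_
      have := mul_le_mul_of_nonneg_left
        ((hσ.tensorPower n).excess_le_one (Real.exp_pos (n * γ)).le) h0.le
      linarith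
    linarith

/-- Writing ρ = XᴴX, the vector with coefficient matrix Xᴴ purifies ρ. -/
lemma exists_purification {m : Type} [Fintype m] [DecidableEq m] {ρ : Matrix m m ℂ}
    (h : IsState ρ) : ∃ φ : EuclideanSpace ℂ (m × m), ‖φ‖ = 1 ∧ reducedA (ketBra φ) = ρ := by
  open scoped MatrixOrder in
  obtain ⟨X, hX⟩ := CStarAlgebra.nonneg_iff_eq_star_mul_self.mp h.1.nonneg
  rw [star_eq_conjTranspose] at hX
  have h1 : Xᴴ * Xᴴᴴ = ρ := by rw [conjTranspose_conjTranspose, hX]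
  have h2 : frobSq Xᴴ = 1 := by rw [← re_trace_mul_conjTranspose, h1, h.2, Complex.one_re]
  refine ⟨WithLp.toLp 2 fun p => Xᴴ p.1 p.2, ?_, h1⟩
  have h3 : ‖(WithLp.toLp 2 fun p => Xᴴ p.1 p.2 : EuclideanSpace ℂ (m × m))‖ ^ 2 = 1 := by
    rw [← frobSq_coeffMatrix, ← h2]; rfl
  exact (pow_eq_one_iff_of_nonneg (norm_nonneg _) two_ne_zero).1 h3

end MixedPower

/-! ### Rank of the reduced states and independence of index 0 -/

section Main

variable {A B : ℕ → Type} [∀ n, Fintype (A n)] [∀ n, DecidableEq (A n)]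
  [∀ n, Fintype (B n)] [∀ n, DecidableEq (B n)]
  {φ : ∀ n, EuclideanSpace ℂ (A n × B n)}

/-- The entropy estimates involve only the rank, so a bound on the smaller local dimension suffices.
-/
lemma rank_reducedSeqA_le (n : ℕ) :
    (reducedSeqA φ n).rank ≤ min (Fintype.card (A n)) (Fintype.card (B n)) :=
  le_min (rank_le_card_height _)
    ((rank_mul_le_left (coeffMatrix (φ n)) _).trans (rank_le_card_width _))

lemma infEntropyRate_congr {ι : ℕ → Type} [∀ n, Fintype (ι n)] [∀ n, DecidableEq (ι n)]
    {ρ ρ' : ∀ n, Matrix (ι n) (ι n) ℂ} (hρ : ∀ n, 1 ≤ n → IsState (ρ n))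
    (h : ∀ n, 1 ≤ n → ρ' n = ρ n) : infEntropyRate ρ' = infEntropyRate ρ := by
  rw [infEntropyRate_eq hρ, infEntropyRate_eq fun n hn => h n hn ▸ hρ n hn]
  congr 3
  ext γ
  exact tendsto_congr' (eventually_atTop.2 ⟨1, fun n hn => by simp only [h n hn]⟩)

lemma supEntropyRate_congr {ι : ℕ → Type} [∀ n, Fintype (ι n)] [∀ n, DecidableEq (ι n)]
    {ρ ρ' : ∀ n, Matrix (ι n) (ι n) ℂ} (hρ : ∀ n, 1 ≤ n → IsState (ρ n))
    (h : ∀ n, 1 ≤ n → ρ' n = ρ n) : supEntropyRate ρ' = supEntropyRate ρ := by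
  rw [supEntropyRate_eq hρ, supEntropyRate_eq fun n hn => h n hn ▸ hρ n hn]
  congr 3
  ext γ
  exact tendsto_congr' (eventually_atTop.2 ⟨1, fun n hn => by simp only [h n hn]⟩)

end Main

end BipartiteEntanglement

end

/-! ### Assembly of the main theorem -/

theorem mainTheorem7 :
    -- general sequences of bipartite pure states
    (∀ (A B : ℕ → Type) [∀ n, Fintype (A n)] [∀ n, DecidableEq (A n)]
        [∀ n, Fintype (B n)] [∀ n, DecidableEq (B n)]
        (φ : ∀ n, EuclideanSpace ℂ (A n × B n)), (∀ n, 1 ≤ n → ‖φ n‖ = 1) →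
      ∀ c : CommClass,
        (distillableEntanglement c φ = infEntropyRate (reducedSeqA φ) ∧
          distillableEntanglement c φ = infEntropyRate (reducedSeqB φ) ∧
          entanglementCost c φ = supEntropyRate (reducedSeqA φ) ∧
          entanglementCost c φ = supEntropyRate (reducedSeqB φ)) ∧
        ((distillableEntanglement c φ = entanglementCost c φ ↔
            IsInformationStable (reducedSeqA φ)) ∧
          (distillableEntanglement c φ = entanglementCost c φ ↔
            IsInformationStable (reducedSeqB φ))) ∧
        ((∃ d : ℕ, ∀ n, 1 ≤ n → min (Fintype.card (A n)) (Fintype.card (B n)) ≤ d ^ n) →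
          distillableEntanglement c φ = entanglementCost c φ →
          ∃ E : ℝ, distillableEntanglement c φ = (E : EReal) ∧
            entanglementCost c φ = (E : EReal) ∧
            Filter.Tendsto (fun n : ℕ => 1 / (n : ℝ) * vonNeumannEntropy (reducedSeqA φ n))
              Filter.atTop (nhds E) ∧
            Filter.Tendsto (fun n : ℕ => 1 / (n : ℝ) * vonNeumannEntropy (reducedSeqB φ n))
              Filter.atTop (nhds E))) ∧
    -- mixtures of tensor powers
    (∀ (ι : Type) [Fintype ι] [DecidableEq ι] (σ ω : Matrix ι ι ℂ) (t : ℝ),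
      IsState σ → IsState ω → 0 < t → t < 1 → vonNeumannEntropy σ < vonNeumannEntropy ω →
      (∃ φ : ∀ n, EuclideanSpace ℂ ((Fin n → ι) × (Fin n → ι)),
        ∀ n, 1 ≤ n → ‖φ n‖ = 1 ∧ reducedSeqA φ n = mixedPower t σ ω n) ∧
      (∀ (B : ℕ → Type) [∀ n, Fintype (B n)] [∀ n, DecidableEq (B n)]
          (φ : ∀ n, EuclideanSpace ℂ ((Fin n → ι) × B n)),
        (∀ n, 1 ≤ n → ‖φ n‖ = 1 ∧ reducedSeqA φ n = mixedPower t σ ω n) →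
        ∀ c : CommClass,
          distillableEntanglement c φ = (vonNeumannEntropy σ : EReal) ∧
          entanglementCost c φ = (vonNeumannEntropy ω : EReal) ∧
          distillableEntanglement c φ < entanglementCost c φ ∧
          ¬ IsInformationStable (reducedSeqA φ)) ∧
      (∀ (A : ℕ → Type) [∀ n, Fintype (A n)] [∀ n, DecidableEq (A n)]
          (φ : ∀ n, EuclideanSpace ℂ (A n × (Fin n → ι))),
        (∀ n, 1 ≤ n → ‖φ n‖ = 1 ∧ reducedSeqB φ n = mixedPower t σ ω n) →
        ∀ c : CommClass,
          distillableEntanglement c φ = (vonNeumannEntropy σ : EReal) ∧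
          entanglementCost c φ = (vonNeumannEntropy ω : EReal) ∧
          distillableEntanglement c φ < entanglementCost c φ ∧
          ¬ IsInformationStable (reducedSeqB φ))) := by
  refine ⟨?_, ?_⟩
  · intro A B _ _ _ _ φ hφ c
    have hD := distillableEntanglement_eq hφ c
    have hC := entanglementCost_eq hφ c
    have hI := infEntropyRate_reducedSeqB hφ
    have hS := supEntropyRate_reducedSeqB hφ
    refine ⟨⟨hD, hD.trans hI.symm, hC, hC.trans hS.symm⟩, ⟨?_, ?_⟩, ?_⟩
    · rw [hD, hC]; rfl
    · rw [hD, hC, ← hI, ← hS]; rfl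
    · rintro ⟨d, hd⟩ h
      obtain ⟨E, hE, hT⟩ := exists_entropyRate (isState_reducedSeqA hφ)
        (fun n hn => (rank_reducedSeqA_le n).trans (hd n hn)) (hD.symm.trans (h.trans hC))
      refine ⟨E, hD.trans hE, h.symm.trans (hD.trans hE), hT, ?_⟩
      simpa only [reducedSeqA, reducedSeqB, vonNeumannEntropy_reducedB_eq] using hT
  · intro ι _ _ σ ω t hσ hω h0 h1 hS
    have hst := isState_mixedPower hσ hω h0 h1
    have hlt : ((vonNeumannEntropy σ : ℝ) : EReal) < (vonNeumannEntropy ω : ℝ) :=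
      EReal.coe_lt_coe_iff.2 hS
    have hinf := infEntropyRate_mixedPower hσ hω h0 h1 hS
    have hsup := supEntropyRate_mixedPower hσ hω h0 h1 hS
    refine ⟨?_, ?_, ?_⟩
    · choose φ hφ using fun n => exists_purification (hst n)
      exact ⟨φ, fun n _ => hφ n⟩
    · intro B _ _ φ hφ c
      have hn : ∀ n, 1 ≤ n → ‖φ n‖ = 1 := fun n hn => (hφ n hn).1
      have hI := (infEntropyRate_congr (fun n _ => hst n) fun n hn => (hφ n hn).2).trans hinf
      have hS := (supEntropyRate_congr (fun n _ => hst n) fun n hn => (hφ n hn).2).trans hsup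
      have hD := (distillableEntanglement_eq hn c).trans hI
      have hC := (entanglementCost_eq hn c).trans hS
      refine ⟨hD, hC, by rw [hD, hC]; exact hlt, fun h => hlt.ne ?_⟩
      exact hI.symm.trans (h.trans hS)
    · intro A _ _ φ hφ c
      have hn : ∀ n, 1 ≤ n → ‖φ n‖ = 1 := fun n hn => (hφ n hn).1
      have hI := (infEntropyRate_congr (fun n _ => hst n) fun n hn => (hφ n hn).2).trans hinf
      have hS := (supEntropyRate_congr (fun n _ => hst n) fun n hn => (hφ n hn).2).trans hsup
      have hD := ((distillableEntanglement_eq hn c).trans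
        (infEntropyRate_reducedSeqB hn).symm).trans hI
      have hC := ((entanglementCost_eq hn c).trans (supEntropyRate_reducedSeqB hn).symm).trans hS
      refine ⟨hD, hC, by rw [hD, hC]; exact hlt, fun h => hlt.ne ?_⟩
      exact hI.symm.trans (h.trans hS)
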